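/- **Setting.** On $\mathbb C^3$ consider the pseudo-Hermitian product $\langle z,w\rangle=i(\bar z^1w^3-\bar z^3w^1)+\bar z^2w^2$, and let $\mathcal S=\{[z]\in\mathbb{CP}^2:\langle z,z\rangle=0\}$, the standard Cauchy--Riemann 3-sphere. A *Legendrian curve* is a smooth immersion $\gamma:\mathbb R\to\mathcal S$ tangent to the contact distribution, i.e. $\langle\Gamma,\Gamma'\rangle=0$ for every local smooth lift $\Gamma$ of $\gamma$ to $\mathbb C^3\setminus\{0\}$. It has a smooth lift $\Gamma$ with $\det(\Gamma,\Gamma',\Gamma'')=i$, unique up to a cubic root of unity; put $a=\mathrm{Im}\langle\Gamma''',\Gamma''\rangle$ and $b=\frac12\langle\Gamma'',\Gamma''\rangle$. The curve is *generic* if $a$ never vanishes, and is parameterized by the *natural parameter* if the strain density $\sqrt[3]{|a|}$ is identically $1$; in that case $\kappa=b$ is its *cr-curvature*. The *stress density* is $$\begin{aligned}\mathtt t={}&\tfrac{4400}{81}aa'^3a''+a^2\big(-\tfrac{400}{27}ba'^3-\tfrac{200}{9}a'a''^2-\tfrac{400}{27}a'^2a'''\big)+a^3\big(\tfrac{25}{3}a'^2b'+\tfrac{50}{3}ba'a''+\tfrac{50}{9}a''a'''+\tfrac{25}{9}a'a^{(4)}\big)\\&+a^4\big(-\tfrac{16}{3}b^2a'-5b'a''-3a'b''-\tfrac{10}{3}ba'''-\tfrac13a^{(5)}\big)+a^5(8bb'+b''')-\tfrac{6160}{243}a'^5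 ;\end{aligned}$$ in the natural parameter $\mathtt t=0$ means $\kappa'''+8\kappa\kappa'=0$. A *cr-string* is a generic Legendrian curve $\gamma:\mathbb R\to\mathcal S$ parameterized by the natural parameter, with non-constant periodic cr-curvature and $\mathtt t=0$. For $m\in(0,1)$ and $\ell>0$, it has *characters* $(m,\ell)$ if, up to a translation of the parameter, its cr-curvature is $$\kappa_{m,\ell}(s)=\tfrac32\ell^2\Big(\tfrac{m+1}{3}-m\,\mathrm{sn}^2(\ell s,m)\Big),$$ where $\mathrm{sn}(\cdot,m)$ is the Jacobi elliptic sine with parameter $m$ (the square of the modulus). A cr-string is *closed* if $\gamma$ is periodic. Put $$\mathtt p(m,\ell)=64\big(m^2(m-1)^2\ell^{12}+2(m-2)(1+m)(2m-1)\ell^6-27\big),$$ $$\widetilde{\mathtt p}(m,\ell)=\frac{(m-2)(1+m)(2m-1)\ell^6-27}{2(1+(m-1)m)^{3/2}\ell^6},$$ where $\mathtt p(m,\ell)>0$ if and only if $|\widetilde{\mathtt p}(m,\ell)|<1$. When $\mathtt p(m,\ell)>0$, put $\alpha=\frac13\arcsin\widetilde{\mathtt p}(m,\ell)$ and $$\lambda_2=-\tfrac43\sqrt{1+m(m-1)}\,\ell^2\sin\alpha,\qquad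 \lambda_3=\tfrac23\sqrt{1+m(m-1)}\,\ell^2\sin\alpha+\tfrac{2}{\sqrt3}\sqrt{1+m(m-1)}\,\ell^2\cos\alpha,$$ $$\Theta_j(m,\ell)=\frac{6\,\Pi\!\left(\frac{6m\ell^2}{2(1+m)\ell^2+3\lambda_j},m\right)}{\pi\ell\,\big(2(1+m)\ell^2+3\lambda_j\big)}\quad(j=2,3),\qquad \Pi(n,m)=\int_0^{\pi/2}\frac{d\theta}{(1-n\sin^2\theta)\sqrt{1-m\sin^2\theta}} .$$ **Theorem.** Let $m\in(0,1)$, $\ell>0$, and let $\gamma$ be a cr-string with characters $(m,\ell)$. Then $\gamma$ is closed if and only if $\mathtt p(m,\ell)>0$ and $\Theta_2(m,\ell)$ and $\Theta_3(m,\ell)$ are both rational. -/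

import Mathlib

open scoped LinearAlgebra.Projectivization ContDiff

noncomputable section

namespace CRString

/-- The pseudo-Hermitian inner product
`⟨z, w⟩ = i (z̄¹ w³ - z̄³ w¹) + z̄² w²` of signature `(2, 1)` on `ℂ³`. -/
def herm (z w : Fin 3 → ℂ) : ℂ :=
  Complex.I * (star (z 0) * w 2 - star (z 2) * w 0) + star (z 1) * w 1

/-- The complex projective plane. -/
abbrev CP2 : Type := ℙ ℂ (Fin 3 → ℂ)

/-- The real hyperquadric `⟨z, z⟩ = 0` in the complex projective plane, that is, the standard
Cauchy-Riemann three-sphere. -/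
def quadric : Set CP2 := {x | herm x.rep x.rep = 0}

theorem herm_smul_smul (c : ℂ) (z w : Fin 3 → ℂ) :
    herm (c • z) (c • w) = star c * c * herm z w := by
  simp only [herm, Pi.smul_apply, smul_eq_mul, star_mul']
  ring

/-- Membership in the quadric can be tested on any homogeneous coordinate vector. -/
theorem mk_mem_quadric (z : Fin 3 → ℂ) (hz : z ≠ 0) :
    Projectivization.mk ℂ z hz ∈ quadric ↔ herm z z = 0 := by
  obtain ⟨a, ha⟩ := Projectivization.exists_smul_eq_mk_rep ℂ z hz
  have h : (Projectivization.mk ℂ z hz).rep = (a : ℂ) • z := ha.symm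
  simp only [quadric, Set.mem_ofPred_eq, h, herm_smul_smul]
  simp

/-- `Γ` is a lift of `γ` over `J`: it is nowhere zero there and `γ = [Γ]`. -/
def IsLiftOn (γ : ℝ → CP2) (Γ : ℝ → Fin 3 → ℂ) (J : Set ℝ) : Prop :=
  ∀ t ∈ J, ∃ h : Γ t ≠ 0, γ t = Projectivization.mk ℂ (Γ t) h

/-- A Legendrian curve defined on the whole line: a smooth immersion into the quadric, tangent to
the contact distribution.  A curve in the projective plane is smooth when it has smooth lifts
`Γ` to `ℂ³ \ {0}` locally.  Its velocity is the class of `Γ'` modulo `ℂ Γ`, so it is an immersion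
when `Γ` and `Γ'` are linearly independent over `ℂ`, and it is tangent to the contact
distribution when the contact form `-i ⟨Γ, dΓ⟩ / |Γ|²` vanishes on its velocity. -/
def IsLegendrian (γ : ℝ → CP2) : Prop :=
  (∀ t, γ t ∈ quadric) ∧
  ∀ t₀ : ℝ, ∃ (J : Set ℝ) (Γ : ℝ → Fin 3 → ℂ),
    IsOpen J ∧ t₀ ∈ J ∧ ContDiffOn ℝ ∞ Γ J ∧ IsLiftOn γ Γ J ∧
    (∀ t ∈ J, LinearIndependent ℂ ![Γ t, deriv Γ t]) ∧
    (∀ t ∈ J, herm (Γ t) (deriv Γ t) = 0)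

/-- A normalized lift: a smooth global lift with `det (Γ, Γ', Γ'') = i`. -/
def IsNormalizedLift (γ : ℝ → CP2) (Γ : ℝ → Fin 3 → ℂ) : Prop :=
  ContDiff ℝ ∞ Γ ∧ IsLiftOn γ Γ Set.univ ∧
  ∀ t, (Matrix.of ![Γ t, deriv Γ t, iteratedDeriv 2 Γ t]).det = Complex.I

open Classical in
/-- A normalized lift of a Legendrian curve (such a lift exists, and it is unique up to
multiplication by a cubic root of unity, which does not affect the densities below). -/
def normalizedLift (γ : ℝ → CP2) : ℝ → Fin 3 → ℂ :=
  if h : ∃ Γ, IsNormalizedLift γ Γ then h.choose else fun _ => 0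

/-- The density `a = Im ⟨Γ''', Γ''⟩` of the cubic Fubini form. -/
def cubicDensity (γ : ℝ → CP2) (t : ℝ) : ℝ :=
  (herm (iteratedDeriv 3 (normalizedLift γ) t) (iteratedDeriv 2 (normalizedLift γ) t)).im

/-- The density `b = ⟨Γ'', Γ''⟩ / 2` of the quadratic Fubini form (`⟨Γ'', Γ''⟩` is real). -/
def quadraticDensity (γ : ℝ → CP2) (t : ℝ) : ℝ :=
  (herm (iteratedDeriv 2 (normalizedLift γ) t) (iteratedDeriv 2 (normalizedLift γ) t)).re / 2

/-- The strain density `|a|^(1/3)`. -/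
def strainDensity (γ : ℝ → CP2) (t : ℝ) : ℝ := |cubicDensity γ t| ^ (1 / 3 : ℝ)

/-- A Legendrian curve without sextactic points. -/
def IsGeneric (γ : ℝ → CP2) : Prop := ∀ t, cubicDensity γ t ≠ 0

/-- Parameterization by the natural parameter. -/
def IsNatural (γ : ℝ → CP2) : Prop := ∀ t, strainDensity γ t = 1

/-- The cr-curvature of a generic Legendrian curve parameterized by the natural parameter is its
quadratic Fubini density. -/
def crCurvature (γ : ℝ → CP2) : ℝ → ℝ := quadraticDensity γ

/-- The stress density as a differential expression in the Fubini densities `a`, `b`. -/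
def stressExpr (a b : ℝ → ℝ) (t : ℝ) : ℝ :=
  let A : ℕ → ℝ := fun k => iteratedDeriv k a t
  let B : ℕ → ℝ := fun k => iteratedDeriv k b t
  4400 / 81 * A 0 * A 1 ^ 3 * A 2
  + A 0 ^ 2 * (-(400 / 27) * B 0 * A 1 ^ 3 - 200 / 9 * A 1 * A 2 ^ 2
      - 400 / 27 * A 1 ^ 2 * A 3)
  + A 0 ^ 3 * (25 / 3 * A 1 ^ 2 * B 1 + 50 / 3 * B 0 * A 1 * A 2 + 50 / 9 * A 2 * A 3
      + 25 / 9 * A 1 * A 4)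
  + A 0 ^ 4 * (-(16 / 3) * B 0 ^ 2 * A 1 - 5 * B 1 * A 2 - 3 * A 1 * B 2
      - 10 / 3 * B 0 * A 3 - 1 / 3 * A 5)
  + A 0 ^ 5 * (8 * B 0 * B 1 + B 3)
  - 6160 / 243 * A 1 ^ 5

/-- The stress density of a Legendrian curve. -/
def stressDensity (γ : ℝ → CP2) : ℝ → ℝ :=
  stressExpr (cubicDensity γ) (quadraticDensity γ)

/-- A cr-string: a generic Legendrian curve parameterized by the natural parameter, with
non-constant periodic cr-curvature and zero stress tensor. -/
structure IsString (γ : ℝ → CP2) : Prop where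
  legendrian : IsLegendrian γ
  generic : IsGeneric γ
  natural : IsNatural γ
  periodic : ∃ T : ℝ, 0 < T ∧ Function.Periodic (crCurvature γ) T
  nonconstant : ¬ ∃ c : ℝ, ∀ s, crCurvature γ s = c
  stress_eq_zero : ∀ t, stressDensity γ t = 0

/-- A parameterized curve on the line is closed when it is periodic. -/
def IsClosedCurve (γ : ℝ → CP2) : Prop := ∃ T : ℝ, 0 < T ∧ Function.Periodic γ T

/-- The incomplete elliptic integral of the first kind `F(φ, m)`; the parameter `m` is the square
of the modulus. -/
def ellipticF (m φ : ℝ) : ℝ := ∫ θ in (0 : ℝ)..φ, 1 / Real.sqrt (1 - m * Real.sin θ ^ 2)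

/-- The Jacobi amplitude: the inverse of `F(·, m)`, which for `0 < m < 1` is an increasing
bijection of the line. -/
def jacobiAm (m : ℝ) : ℝ → ℝ := Function.invFun (ellipticF m)

/-- The Jacobi elliptic sine `sn(u, m)`. -/
def jacobiSn (u m : ℝ) : ℝ := Real.sin (jacobiAm m u)

/-- The complete elliptic integral of the third kind `Π(n, m)`. -/
def ellipticPi (n m : ℝ) : ℝ :=
  ∫ θ in (0 : ℝ)..(Real.pi / 2),
    1 / ((1 - n * Real.sin θ ^ 2) * Real.sqrt (1 - m * Real.sin θ ^ 2))

/-- The model curvature function `κ_{m,ℓ}`. -/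
def modelCurvature (m ℓ s : ℝ) : ℝ :=
  3 / 2 * ℓ ^ 2 * ((m + 1) / 3 - m * jacobiSn (ℓ * s) m ^ 2)

/-- `(m, ℓ)` are characters of the curve: its cr-curvature is `κ_{m,ℓ}` up to a translation of the
natural parameter. -/
def HasCharacters (γ : ℝ → CP2) (m ℓ : ℝ) : Prop :=
  ∃ s₀ : ℝ, ∀ s, crCurvature γ s = modelCurvature m ℓ (s + s₀)

/-- The discriminant `p(m, ℓ)` of the momentum of a string with characters `(m, ℓ)`. -/
def momentumDiscr (m ℓ : ℝ) : ℝ :=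
  64 * (m ^ 2 * (m - 1) ^ 2 * ℓ ^ 12 + 2 * (m - 2) * (1 + m) * (2 * m - 1) * ℓ ^ 6 - 27)

/-- The auxiliary quantity `p̃(m, ℓ)`; it lies in `(-1, 1)` if and only if `p(m, ℓ) > 0`. -/
def momentumAux (m ℓ : ℝ) : ℝ :=
  ((m - 2) * (1 + m) * (2 * m - 1) * ℓ ^ 6 - 27) /
    (2 * (1 + (m - 1) * m) ^ (3 / 2 : ℝ) * ℓ ^ 6)

/-- The middle eigenvalue `λ₂(m, ℓ)` of the momentum; meaningful for `p(m, ℓ) ≥ 0`, where the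
spectrum is real. -/
def eigenvalue₂ (m ℓ : ℝ) : ℝ :=
  -(4 / 3) * Real.sqrt (1 + m * (m - 1)) * ℓ ^ 2 * Real.sin (Real.arcsin (momentumAux m ℓ) / 3)

/-- The largest eigenvalue `λ₃(m, ℓ)` of the momentum; meaningful for `p(m, ℓ) ≥ 0`, where the
spectrum is real. -/
def eigenvalue₃ (m ℓ : ℝ) : ℝ :=
  2 / 3 * Real.sqrt (1 + m * (m - 1)) * ℓ ^ 2 * Real.sin (Real.arcsin (momentumAux m ℓ) / 3)
  + 2 / Real.sqrt 3 * Real.sqrt (1 + m * (m - 1)) * ℓ ^ 2 *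
      Real.cos (Real.arcsin (momentumAux m ℓ) / 3)

/-- The period attached to a real eigenvalue `lam` of the momentum. -/
def periodOf (m ℓ lam : ℝ) : ℝ :=
  6 * ellipticPi (6 * m * ℓ ^ 2 / (2 * (1 + m) * ℓ ^ 2 + 3 * lam)) m /
    (Real.pi * ℓ * (2 * (1 + m) * ℓ ^ 2 + 3 * lam))

/-- `Θ₂(m, ℓ)`. -/
def Theta₂ (m ℓ : ℝ) : ℝ := periodOf m ℓ (eigenvalue₂ m ℓ)

/-- `Θ₃(m, ℓ)`. -/
def Theta₃ (m ℓ : ℝ) : ℝ := periodOf m ℓ (eigenvalue₃ m ℓ)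

end CRString

end

noncomputable section

namespace CRString

/-! The closing problem is a monodromy problem for a third-order linear equation that can be solved
explicitly. The Gram matrix of `(Γ, Γ', Γ'')` is determined by `b`, so a normalized lift satisfies
`Γ''' = (-b' + i a) Γ - 2 b Γ'` (`structure_equation`). In the natural parameter `a = ±1`;
conjugating the lift when `a = -1`, its components form a fundamental system of `y''' = (-k' + i) y
- 2 k y'` with `k` a translate of `κ_{m,ℓ}`. The curve is closed exactly when the lift is periodic
(`isClosedCurve_iff`), hence exactly when all solutions have a common period, necessarily a multiple
of the wavelength of `κ_{m,ℓ}`.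

Write `P = ∂³ + 2k∂ + k'` and `L = ∂² + (4/3) k`. These commute exactly when `k''' + 8 k k' = 0`, so
`L` acts on the solutions of `P y = i y`: this is the momentum. Differentiating `y'' = (μ - (4/3) k)
y` and comparing with the structure equation gives `(3μ + 2k) y' = (k' + 3i) y`; compatibility is
the cubic `charPoly C E μ = 0`, where `λ = 2μ` is the eigenvalue in the statement.

For such a solution `y² / (3μ + 2k)` has logarithmic derivative `6i / (3μ + 2k)`. Over one
wavelength the squared multiplier is therefore the exponential of a complete elliptic integral of
the third kind, namely `exp (4πiΘ)` for real `λ` (`eigenFun_sq_wavelength`). It is a root of unity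
if and only if `Θ` is rational.

The number `p(m, ℓ)` is the discriminant of the cubic. If it is not positive, a nonreal root gives a
multiplier of modulus different from one, or a real double root gives a Jordan block, and either
prevents closing. If it is positive there are three distinct real roots; since the Wronskian is
constant the multipliers have product one, so two of them decide. -/

/-! ### The elliptic integral of the first kind and the Jacobi amplitude. -/

theorem one_sub_mul_sin_sq_pos {m : ℝ} (hm0 : 0 < m) (hm1 : m < 1) (θ : ℝ) :
    0 < 1 - m * Real.sin θ ^ 2 := by
  nlinarith [Real.sin_sq_le_one θ]

theorem continuous_ellipticF_integrand {m : ℝ} (hm0 : 0 < m) (hm1 : m < 1) :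
    Continuous fun θ : ℝ => 1 / Real.sqrt (1 - m * Real.sin θ ^ 2) := by
  refine Continuous.div continuous_const (by fun_prop) fun θ => ?_
  exact (Real.sqrt_pos.2 (one_sub_mul_sin_sq_pos hm0 hm1 θ)).ne'

theorem hasDerivAt_ellipticF {m : ℝ} (hm0 : 0 < m) (hm1 : m < 1) (φ : ℝ) :
    HasDerivAt (ellipticF m) (1 / Real.sqrt (1 - m * Real.sin φ ^ 2)) φ :=
  ((continuous_ellipticF_integrand hm0 hm1).integral_hasStrictDerivAt 0 φ).hasDerivAt

theorem ellipticF_zero (m : ℝ) : ellipticF m 0 = 0 := by simp [ellipticF]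

theorem strictMono_ellipticF {m : ℝ} (hm0 : 0 < m) (hm1 : m < 1) : StrictMono (ellipticF m) :=
  strictMono_of_deriv_pos fun φ => by
    rw [(hasDerivAt_ellipticF hm0 hm1 φ).deriv]
    exact one_div_pos.2 (Real.sqrt_pos.2 (one_sub_mul_sin_sq_pos hm0 hm1 φ))

/-- The integrand of `F` is at least one. Comparison with the identity then makes `F` unbounded in
both directions, hence surjective. -/
theorem monotone_ellipticF_sub_id {m : ℝ} (hm0 : 0 < m) (hm1 : m < 1) :
    Monotone fun φ => ellipticF m φ - φ := by
  have hd : ∀ φ, HasDerivAt (fun φ => ellipticF m φ - φ)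
      (1 / Real.sqrt (1 - m * Real.sin φ ^ 2) - 1) φ := fun φ =>
    (hasDerivAt_ellipticF hm0 hm1 φ).sub (hasDerivAt_id φ)
  refine monotone_of_deriv_nonneg (fun φ => (hd φ).differentiableAt) fun φ => ?_
  rw [(hd φ).deriv, sub_nonneg]
  refine (one_le_div (Real.sqrt_pos.2 (one_sub_mul_sin_sq_pos hm0 hm1 φ))).2 ?_
  rw [Real.sqrt_le_one]
  nlinarith [sq_nonneg (Real.sin φ)]

theorem continuous_ellipticF {m : ℝ} (hm0 : 0 < m) (hm1 : m < 1) : Continuous (ellipticF m) :=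
  continuous_iff_continuousAt.2 fun φ => (hasDerivAt_ellipticF hm0 hm1 φ).continuousAt

theorem surjective_ellipticF {m : ℝ} (hm0 : 0 < m) (hm1 : m < 1) :
    Function.Surjective (ellipticF m) := by
  have hmono := monotone_ellipticF_sub_id hm0 hm1
  refine (continuous_ellipticF hm0 hm1).surjective ?_ ?_
  · refine Filter.tendsto_atTop_mono' _ ?_ Filter.tendsto_id
    filter_upwards [Filter.eventually_ge_atTop 0] with φ hφ
    have := hmono hφ
    simp only [ellipticF_zero] at this
    simpa using this
  · refine Filter.tendsto_atBot_mono' _ ?_ Filter.tendsto_id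
    filter_upwards [Filter.eventually_le_atBot 0] with φ hφ
    have := hmono hφ
    simp only [ellipticF_zero] at this
    simpa using this

theorem ellipticF_jacobiAm {m : ℝ} (hm0 : 0 < m) (hm1 : m < 1) (u : ℝ) :
    ellipticF m (jacobiAm m u) = u :=
  Function.rightInverse_invFun (surjective_ellipticF hm0 hm1) u

theorem jacobiAm_ellipticF {m : ℝ} (hm0 : 0 < m) (hm1 : m < 1) (φ : ℝ) :
    jacobiAm m (ellipticF m φ) = φ :=
  Function.leftInverse_invFun (strictMono_ellipticF hm0 hm1).injective φ

theorem jacobiAm_zero {m : ℝ} (hm0 : 0 < m) (hm1 : m < 1) : jacobiAm m 0 = 0 := by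
  simpa [ellipticF_zero] using jacobiAm_ellipticF hm0 hm1 0

theorem continuous_jacobiAm {m : ℝ} (hm0 : 0 < m) (hm1 : m < 1) : Continuous (jacobiAm m) := by
  refine Monotone.continuous_of_surjective (fun u v huv => ?_)
    fun φ => ⟨_, jacobiAm_ellipticF hm0 hm1 φ⟩
  rw [← (strictMono_ellipticF hm0 hm1).le_iff_le]
  simpa only [ellipticF_jacobiAm hm0 hm1] using huv

theorem hasDerivAt_jacobiAm {m : ℝ} (hm0 : 0 < m) (hm1 : m < 1) (u : ℝ) :
    HasDerivAt (jacobiAm m) (Real.sqrt (1 - m * Real.sin (jacobiAm m u) ^ 2)) u := by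
  have h := HasDerivAt.of_local_left_inverse (continuous_jacobiAm hm0 hm1).continuousAt
    (hasDerivAt_ellipticF hm0 hm1 (jacobiAm m u))
    (one_div_pos.2 (Real.sqrt_pos.2 (one_sub_mul_sin_sq_pos hm0 hm1 _))).ne'
    (Filter.Eventually.of_forall (ellipticF_jacobiAm hm0 hm1))
  simpa using h

theorem ellipticF_add_pi {m : ℝ} (hm0 : 0 < m) (hm1 : m < 1) (φ : ℝ) :
    ellipticF m (φ + Real.pi) = ellipticF m φ + ellipticF m Real.pi := by
  have hi : ∀ a b, IntervalIntegrable (fun θ : ℝ => 1 / Real.sqrt (1 - m * Real.sin θ ^ 2))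
      MeasureTheory.volume a b := fun a b =>
    (continuous_ellipticF_integrand hm0 hm1).intervalIntegrable a b
  have hp : Function.Periodic (fun θ : ℝ => 1 / Real.sqrt (1 - m * Real.sin θ ^ 2)) Real.pi := by
    intro θ
    simp [Real.sin_add_pi]
  have h := hp.intervalIntegral_add_eq φ 0
  rw [zero_add] at h
  unfold ellipticF
  rw [← intervalIntegral.integral_add_adjacent_intervals (hi 0 φ) (hi φ (φ + Real.pi)), h]

theorem jacobiAm_add {m : ℝ} (hm0 : 0 < m) (hm1 : m < 1) (u : ℝ) :
    jacobiAm m (u + ellipticF m Real.pi) = jacobiAm m u + Real.pi := by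
  apply (strictMono_ellipticF hm0 hm1).injective
  rw [ellipticF_jacobiAm hm0 hm1, ellipticF_add_pi hm0 hm1, ellipticF_jacobiAm hm0 hm1]

theorem ellipticF_pi_pos {m : ℝ} (hm0 : 0 < m) (hm1 : m < 1) : 0 < ellipticF m Real.pi := by
  simpa [ellipticF_zero] using strictMono_ellipticF hm0 hm1 Real.pi_pos

theorem ellipticF_int_mul_pi {m : ℝ} (hm0 : 0 < m) (hm1 : m < 1) (n : ℤ) :
    ellipticF m (n * Real.pi) = n * ellipticF m Real.pi := by
  induction n using Int.induction_on with
  | zero => simp [ellipticF_zero]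
  | succ n ih =>
    push_cast at ih ⊢
    rw [add_one_mul, ellipticF_add_pi hm0 hm1, ih]
    ring
  | pred n ih =>
    have h := ellipticF_add_pi hm0 hm1 ((-n - 1) * Real.pi)
    rw [show (-(n : ℝ) - 1) * Real.pi + Real.pi = -n * Real.pi by ring] at h
    push_cast at ih ⊢
    linarith

/-! ### The model curvature: periods, differential equation and energy. -/

/-- The common period of `κ_{m,ℓ}`, twice the complete elliptic integral over `ℓ`. -/
def wavelength (m ℓ : ℝ) : ℝ := ellipticF m Real.pi / ℓ

theorem wavelength_pos {m ℓ : ℝ} (hm0 : 0 < m) (hm1 : m < 1) (hℓ : 0 < ℓ) :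
    0 < wavelength m ℓ := div_pos (ellipticF_pi_pos hm0 hm1) hℓ

theorem jacobiSn_sq_add {m : ℝ} (hm0 : 0 < m) (hm1 : m < 1) (u : ℝ) :
    jacobiSn (u + ellipticF m Real.pi) m ^ 2 = jacobiSn u m ^ 2 := by
  simp [jacobiSn, jacobiAm_add hm0 hm1, Real.sin_add_pi]

theorem periodic_modelCurvature {m ℓ : ℝ} (hm0 : 0 < m) (hm1 : m < 1) (hℓ : 0 < ℓ) :
    Function.Periodic (modelCurvature m ℓ) (wavelength m ℓ) := by
  intro s
  have h : ℓ * (s + wavelength m ℓ) = ℓ * s + ellipticF m Real.pi := by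
    rw [wavelength]; field_simp
  rw [modelCurvature, h, jacobiSn_sq_add hm0 hm1, modelCurvature]

/-- Every positive period of `κ_{m,ℓ}` is a multiple of the wavelength. -/
theorem exists_eq_nat_mul_wavelength {m ℓ T : ℝ} (hm0 : 0 < m) (hm1 : m < 1) (hℓ : 0 < ℓ)
    (hT : 0 < T) (hper : Function.Periodic (modelCurvature m ℓ) T) :
    ∃ n : ℕ, 0 < n ∧ T = n * wavelength m ℓ := by
  -- Since `sn` vanishes at `0`, periodicity tested there forces `sn (ℓT) = 0`, so the amplitude at
  -- `ℓT` is a multiple of `π`.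
  have h := hper 0
  have hs0 : jacobiSn (ℓ * 0) m = 0 := by simp [jacobiSn, jacobiAm_zero hm0 hm1]
  simp only [modelCurvature, hs0, zero_add] at h
  have hs : jacobiSn (ℓ * T) m = 0 := by
    have hc : 3 / 2 * ℓ ^ 2 * m ≠ 0 := by positivity
    have h2 : (3 / 2 * ℓ ^ 2 * m) * jacobiSn (ℓ * T) m ^ 2 = 0 := by linarith
    simpa [hc] using h2
  obtain ⟨n, hn⟩ := Real.sin_eq_zero_iff.1 hs
  have hT' : ℓ * T = n * ellipticF m Real.pi := by
    rw [← ellipticF_int_mul_pi hm0 hm1, hn, ellipticF_jacobiAm hm0 hm1]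
  have hT2 : T = n * wavelength m ℓ := by
    rw [wavelength]; field_simp; linarith
  have hn0 : 0 < n := by
    have : (0 : ℝ) < n := by
      by_contra hcon
      push Not at hcon
      nlinarith [wavelength_pos hm0 hm1 hℓ]
    exact_mod_cast this
  refine ⟨n.toNat, by omega, ?_⟩
  have : ((n.toNat : ℤ) : ℝ) = n := by rw [Int.toNat_of_nonneg hn0.le]
  rw [hT2, ← this]
  push_cast
  rfl

/-- The derivative of `κ_{m,ℓ}`. -/
def modelCurvatureDeriv (m ℓ s : ℝ) : ℝ :=
  -(3 * m * ℓ ^ 3 * Real.sin (jacobiAm m (ℓ * s)) * Real.cos (jacobiAm m (ℓ * s)) *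
    Real.sqrt (1 - m * Real.sin (jacobiAm m (ℓ * s)) ^ 2))

theorem hasDerivAt_jacobiAm_mul {m : ℝ} (hm0 : 0 < m) (hm1 : m < 1) (ℓ s : ℝ) :
    HasDerivAt (fun s => jacobiAm m (ℓ * s))
      (Real.sqrt (1 - m * Real.sin (jacobiAm m (ℓ * s)) ^ 2) * ℓ) s := by
  have h : HasDerivAt (fun s : ℝ => ℓ * s) ℓ s := by
    simpa using (hasDerivAt_id s).const_mul ℓ
  exact (hasDerivAt_jacobiAm hm0 hm1 (ℓ * s)).comp s h

theorem hasDerivAt_modelCurvature {m : ℝ} (hm0 : 0 < m) (hm1 : m < 1) (ℓ s : ℝ) :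
    HasDerivAt (modelCurvature m ℓ) (modelCurvatureDeriv m ℓ s) s := by
  have h := ((((hasDerivAt_jacobiAm_mul hm0 hm1 ℓ s).sin.pow 2).const_mul m).const_sub
    ((m + 1) / 3)).const_mul (3 / 2 * ℓ ^ 2)
  refine h.congr_deriv ?_
  rw [modelCurvatureDeriv]
  push_cast
  ring

theorem hasDerivAt_modelCurvatureDeriv {m : ℝ} (hm0 : 0 < m) (hm1 : m < 1) (ℓ s : ℝ) :
    HasDerivAt (modelCurvatureDeriv m ℓ)
      ((m ^ 2 - m + 1) * ℓ ^ 4 - 4 * modelCurvature m ℓ s ^ 2) s := by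
  have hθ := hasDerivAt_jacobiAm_mul hm0 hm1 ℓ s
  have hpos := one_sub_mul_sin_sq_pos hm0 hm1 (jacobiAm m (ℓ * s))
  have h := (((hθ.sin.const_mul (3 * m * ℓ ^ 3)).mul hθ.cos).mul
    ((((hθ.sin.pow 2).const_mul m).const_sub 1).sqrt hpos.ne')).neg
  refine h.congr_deriv ?_
  have hq := Real.sq_sqrt hpos.le
  have hq0 := (Real.sqrt_pos.2 hpos).ne'
  have hsc := Real.sin_sq_add_cos_sq (jacobiAm m (ℓ * s))
  simp only [modelCurvature, jacobiSn, Pi.pow_apply, Pi.mul_apply] at *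
  set S := Real.sin (jacobiAm m (ℓ * s))
  set c := Real.cos (jacobiAm m (ℓ * s))
  set q := Real.sqrt (1 - m * S ^ 2)
  have hc : c ^ 2 = 1 - S ^ 2 := by linarith
  push_cast
  field_simp
  ring_nf
  simp only [hq, hc]
  ring_nf

theorem modelCurvature_energy {m : ℝ} (hm0 : 0 < m) (hm1 : m < 1) (ℓ s : ℝ) :
    modelCurvatureDeriv m ℓ s ^ 2 = 2 * ((m ^ 2 - m + 1) * ℓ ^ 4) * modelCurvature m ℓ s -
      8 / 3 * modelCurvature m ℓ s ^ 3 + -((m + 1) * (2 * m - 1) * (m - 2) * ℓ ^ 6 / 3) := by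
  have hq := Real.sq_sqrt (one_sub_mul_sin_sq_pos hm0 hm1 (jacobiAm m (ℓ * s))).le
  have hc := Real.cos_sq' (jacobiAm m (ℓ * s))
  simp only [modelCurvature, modelCurvatureDeriv, jacobiSn, neg_sq, mul_pow, hq, hc]
  ring

/-- Substitution of the amplitude in an integral over one wavelength. -/
theorem integral_comp_jacobiAm {m ℓ : ℝ} (hm0 : 0 < m) (hm1 : m < 1) (hℓ : 0 < ℓ) (h : ℝ → ℝ)
    (hc : Continuous fun θ => h (Real.sin θ ^ 2)) :
    ∫ s in (0 : ℝ)..wavelength m ℓ, h (jacobiSn (ℓ * s) m ^ 2) =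
      2 / ℓ * ∫ θ in (0 : ℝ)..(Real.pi / 2),
        h (Real.sin θ ^ 2) * (1 / Real.sqrt (1 - m * Real.sin θ ^ 2)) := by
  have hF := continuous_ellipticF_integrand hm0 hm1
  have hsub := intervalIntegral.integral_comp_mul_deriv (a := 0) (b := Real.pi)
    (f := fun θ => ellipticF m θ / ℓ)
    (f' := fun θ => 1 / Real.sqrt (1 - m * Real.sin θ ^ 2) / ℓ)
    (g := fun s => h (jacobiSn (ℓ * s) m ^ 2))
    (fun θ _ => (hasDerivAt_ellipticF hm0 hm1 θ).div_const ℓ)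
    (hF.div_const ℓ).continuousOn
    (hc.comp ((continuous_jacobiAm hm0 hm1).comp (continuous_const.mul continuous_id)))
  have hk : ∀ θ, ℓ * (ellipticF m θ / ℓ) = ellipticF m θ := fun θ => by field_simp
  simp only [Function.comp_apply, hk, jacobiSn, jacobiAm_ellipticF hm0 hm1, ellipticF_zero,
    zero_div] at hsub
  simp only [wavelength, jacobiSn]
  rw [← hsub]
  set G : ℝ → ℝ := fun θ => h (Real.sin θ ^ 2) * (1 / Real.sqrt (1 - m * Real.sin θ ^ 2)) with hG
  have hGc : Continuous G := hc.mul hF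
  have h1 : ∀ θ, h (Real.sin θ ^ 2) * (1 / Real.sqrt (1 - m * Real.sin θ ^ 2) / ℓ) =
      1 / ℓ * G θ := fun θ => by simp only [hG]; ring
  simp only [h1, intervalIntegral.integral_const_mul]
  -- The reflection `θ ↦ π - θ` preserves the sine; this yields the factor `2` in front of the
  -- integral.
  have h2 : ∫ θ in (Real.pi / 2)..Real.pi, G θ = ∫ θ in (0 : ℝ)..(Real.pi / 2), G θ := by
    have := intervalIntegral.integral_comp_sub_left (a := 0) (b := Real.pi / 2) G Real.pi
    rw [sub_zero, sub_half] at this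
    rw [← this]
    simp only [hG, Real.sin_pi_sub]
  rw [← intervalIntegral.integral_add_adjacent_intervals (hGc.intervalIntegrable 0 (Real.pi / 2))
    (hGc.intervalIntegrable _ _), h2]
  ring

/-! ### The structure equation and its Wronskian. -/

/-- `k` solves `k'' + 4 k² = C` with energy `E`; such functions satisfy `k''' + 8 k k' = 0`. -/
structure IsStressFree (C E : ℝ) (k k' : ℝ → ℝ) : Prop where
  hasDerivAt : ∀ s, HasDerivAt k (k' s) s
  hasDerivAt' : ∀ s, HasDerivAt k' (C - 4 * k s ^ 2) s
  energy : ∀ s, k' s ^ 2 = 2 * C * k s - 8 / 3 * k s ^ 3 + E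

/-- The 2-jet `f` of a solution of the structure equation `y''' = (-k' + i) y - 2 k y'`. -/
structure IsSolution (k k' : ℝ → ℝ) (f : Fin 3 → ℝ → ℂ) : Prop where
  d0 : ∀ s, HasDerivAt (f 0) (f 1 s) s
  d1 : ∀ s, HasDerivAt (f 1) (f 2 s) s
  d2 : ∀ s, HasDerivAt (f 2) ((-k' s + Complex.I) * f 0 s - 2 * k s * f 1 s) s

/-- The Wronskian of three 2-jets. -/
def wronskian (f g h : Fin 3 → ℝ → ℂ) (s : ℝ) : ℂ :=
  f 0 s * (g 1 s * h 2 s - g 2 s * h 1 s) - f 1 s * (g 0 s * h 2 s - g 2 s * h 0 s) +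
    f 2 s * (g 0 s * h 1 s - g 1 s * h 0 s)

theorem eq_of_hasDerivAt_zero {f : ℝ → ℂ} (hf : ∀ s, HasDerivAt f 0 s) (s t : ℝ) : f s = f t :=
  is_const_of_deriv_eq_zero (fun s => (hf s).differentiableAt) (fun s => (hf s).deriv) s t

/-- The equation has no second-order term, so its companion matrix is trace-free. -/
theorem wronskian_const {k k' : ℝ → ℝ} {f g h : Fin 3 → ℝ → ℂ} (hf : IsSolution k k' f)
    (hg : IsSolution k k' g) (hh : IsSolution k k' h) (s t : ℝ) :
    wronskian f g h s = wronskian f g h t := by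
  refine eq_of_hasDerivAt_zero (fun s => ?_) s t
  have := (((hf.d0 s).mul (((hg.d1 s).mul (hh.d2 s)).sub ((hg.d2 s).mul (hh.d1 s)))).sub
    ((hf.d1 s).mul (((hg.d0 s).mul (hh.d2 s)).sub ((hg.d2 s).mul (hh.d0 s))))).add
    ((hf.d2 s).mul (((hg.d0 s).mul (hh.d1 s)).sub ((hg.d1 s).mul (hh.d0 s))))
  refine this.congr_deriv ?_
  simp only [Pi.sub_apply, Pi.mul_apply]
  ring

/-- If a fundamental system of solutions is `T`-periodic, then so is every solution. -/
theorem IsSolution.periodic {k k' : ℝ → ℝ} {f g h u : Fin 3 → ℝ → ℂ} (hf : IsSolution k k' f)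
    (hg : IsSolution k k' g) (hh : IsSolution k k' h) (hu : IsSolution k k' u)
    (hw : wronskian f g h 0 ≠ 0) {T : ℝ} (pf : Function.Periodic (f 0) T)
    (pg : Function.Periodic (g 0) T) (ph : Function.Periodic (h 0) T) :
    Function.Periodic (u 0) T := by
  -- Cramer's rule, with constant coefficients because all the Wronskians are constant.
  have key : ∀ s, wronskian f g h 0 * u 0 s = wronskian u g h 0 * f 0 s +
      wronskian f u h 0 * g 0 s + wronskian f g u 0 * h 0 s := fun s => by
    rw [wronskian_const hf hg hh 0 s, wronskian_const hu hg hh 0 s, wronskian_const hf hu hh 0 s,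
      wronskian_const hf hg hu 0 s]
    simp only [wronskian]
    ring
  intro s
  apply mul_left_cancel₀ hw
  rw [key, key, pf, pg, ph]

/-! ### Eigenfunctions of the momentum and their multipliers. -/

/-- The characteristic polynomial of the momentum. -/
def charPoly (C E : ℝ) (μ : ℂ) : ℂ := 9 * μ ^ 3 - 3 * C * μ + E + 9

/-- The affine function `3 μ + 2 k` of the curvature. -/
def affineCurv (k : ℝ → ℝ) (μ : ℂ) (s : ℝ) : ℂ := 3 * μ + 2 * k s

/-- The logarithmic derivative of an eigenfunction of the momentum. -/
def eigenRate (k k' : ℝ → ℝ) (μ : ℂ) (s : ℝ) : ℂ :=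
  (k' s + 3 * Complex.I) / affineCurv k μ s

/-- The eigenfunction of the momentum with eigenvalue `μ`. -/
def eigenFun (k k' : ℝ → ℝ) (μ : ℂ) (s : ℝ) : ℂ :=
  Complex.exp (∫ t in (0 : ℝ)..s, eigenRate k k' μ t)

/-- The 2-jet of the eigenfunction. -/
def eigenJet (k k' : ℝ → ℝ) (μ : ℂ) : Fin 3 → ℝ → ℂ :=
  ![eigenFun k k' μ, fun s => eigenRate k k' μ s * eigenFun k k' μ s,
    fun s => (μ - 4 / 3 * k s) * eigenFun k k' μ s]

namespace IsStressFree

variable {C E : ℝ} {k k' : ℝ → ℝ} {μ : ℂ}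

theorem energyC (hk : IsStressFree C E k k') (s : ℝ) :
    (k' s : ℂ) ^ 2 = 2 * C * k s - 8 / 3 * k s ^ 3 + E := by
  have h := congrArg (fun x : ℝ => (x : ℂ)) (hk.energy s)
  push_cast at h
  exact h

theorem hasDerivAtC (hk : IsStressFree C E k k') (s : ℝ) :
    HasDerivAt (fun s => (k s : ℂ)) (k' s) s := (hk.hasDerivAt s).ofReal_comp

theorem hasDerivAtC' (hk : IsStressFree C E k k') (s : ℝ) :
    HasDerivAt (fun s => (k' s : ℂ)) (C - 4 * k s ^ 2) s := by
  simpa using (hk.hasDerivAt' s).ofReal_comp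

/-- At a zero `μ` would be real with `k = -3μ/2`, and the energy identity would become `k'² =
charPoly C E μ - 9 = -9`. -/
theorem affineCurv_ne_zero (hk : IsStressFree C E k k') (hμ : charPoly C E μ = 0) (s : ℝ) :
    affineCurv k μ s ≠ 0 := by
  intro h
  by_cases him : μ.im = 0
  · have hμ' : μ = (μ.re : ℂ) := Complex.ext rfl (by simpa using him)
    rw [affineCurv, hμ'] at h
    rw [charPoly, hμ'] at hμ
    have h1 : 3 * μ.re + 2 * k s = 0 := by exact_mod_cast h
    have h2 : 9 * μ.re ^ 3 - 3 * C * μ.re + E + 9 = 0 := by exact_mod_cast hμ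
    have h3 := hk.energy s
    have h4 : k s = -3 / 2 * μ.re := by linarith
    rw [h4] at h3
    nlinarith [sq_nonneg (k' s)]
  · apply him
    have := congrArg Complex.im h
    simpa [affineCurv] using this

theorem hasDerivAt_affineCurv (hk : IsStressFree C E k k') (s : ℝ) :
    HasDerivAt (affineCurv k μ) (2 * k' s) s := by
  exact ((hk.hasDerivAtC s).const_mul 2).const_add (3 * μ)

theorem continuous_affineCurv (hk : IsStressFree C E k k') : Continuous (affineCurv k μ) :=
  continuous_iff_continuousAt.2 fun s => (hk.hasDerivAt_affineCurv s).continuousAt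

theorem continuous_curv (hk : IsStressFree C E k k') : Continuous k :=
  continuous_iff_continuousAt.2 fun s => (hk.hasDerivAt s).continuousAt

theorem continuous_eigenRate (hk : IsStressFree C E k k') (hμ : charPoly C E μ = 0) :
    Continuous (eigenRate k k' μ) := by
  have h1 : Continuous fun s => (k' s : ℂ) :=
    continuous_iff_continuousAt.2 fun s => (hk.hasDerivAtC' s).continuousAt
  exact (h1.add continuous_const).div hk.continuous_affineCurv (hk.affineCurv_ne_zero hμ)

theorem hasDerivAt_eigenFun (hk : IsStressFree C E k k') (hμ : charPoly C E μ = 0) (s : ℝ) :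
    HasDerivAt (eigenFun k k' μ) (eigenRate k k' μ s * eigenFun k k' μ s) s := by
  have h := (((hk.continuous_eigenRate hμ).integral_hasStrictDerivAt 0 s).hasDerivAt).cexp
  exact h.congr_deriv (mul_comm _ _)

/-- The Riccati equation of the eigenfunctions. -/
theorem hasDerivAt_eigenRate (hk : IsStressFree C E k k') (hμ : charPoly C E μ = 0) (s : ℝ) :
    HasDerivAt (eigenRate k k' μ) (μ - 4 / 3 * k s - eigenRate k k' μ s ^ 2) s := by
  have hx := hk.affineCurv_ne_zero hμ s
  have h := ((hk.hasDerivAtC' s).add_const (3 * Complex.I)).div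
    (hk.hasDerivAt_affineCurv (μ := μ) s) hx
  refine h.congr_deriv ?_
  have he := hk.energyC s
  have hI := Complex.I_sq
  simp only [eigenRate]
  field_simp
  simp only [affineCurv, charPoly] at *
  linear_combination (-3 : ℂ) * hμ + (-3 : ℂ) * he + 27 * hI

theorem isSolution_eigenJet (hk : IsStressFree C E k k') (hμ : charPoly C E μ = 0) :
    IsSolution k k' (eigenJet k k' μ) where
  d0 s := hk.hasDerivAt_eigenFun hμ s
  d1 s := by
    refine ((hk.hasDerivAt_eigenRate hμ s).mul (hk.hasDerivAt_eigenFun hμ s)).congr_deriv ?_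
    simp only [eigenJet, Matrix.cons_val]
    ring
  d2 s := by
    refine ((((hk.hasDerivAtC s).const_mul (4 / 3)).const_sub μ).mul
      (hk.hasDerivAt_eigenFun hμ s)).congr_deriv ?_
    have hx := hk.affineCurv_ne_zero hμ s
    simp only [eigenJet, Matrix.cons_val, eigenRate]
    field_simp
    simp only [affineCurv]
    ring

theorem eigenFun_zero : eigenFun k k' μ 0 = 1 := by simp [eigenFun]

theorem eigenFun_ne_zero (s : ℝ) : eigenFun k k' μ s ≠ 0 := Complex.exp_ne_zero _

theorem eigenRate_periodic (hk : IsStressFree C E k k') {T : ℝ} (hp : Function.Periodic k T) :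
    Function.Periodic (eigenRate k k' μ) T := by
  intro s
  have h1 : k' (s + T) = k' s := by
    have h : HasDerivAt (fun s => k (s + T)) (k' (s + T)) s :=
      (hk.hasDerivAt (s + T)).comp_add_const s T
    rw [show (fun s => k (s + T)) = k from funext hp] at h
    exact h.unique (hk.hasDerivAt s)
  simp only [eigenRate, affineCurv, h1, hp s]

/-- The eigenfunction is normalized to `1` at `0`, so its value at a period `T` of the curvature is
its multiplier over `T`. -/
theorem eigenFun_add (hk : IsStressFree C E k k') (hμ : charPoly C E μ = 0) {T : ℝ}
    (hp : Function.Periodic k T) (s : ℝ) :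
    eigenFun k k' μ (s + T) = eigenFun k k' μ s * eigenFun k k' μ T := by
  have hi : ∀ a b, IntervalIntegrable (eigenRate k k' μ) MeasureTheory.volume a b := fun a b =>
    (hk.continuous_eigenRate hμ).intervalIntegrable a b
  have h := (hk.eigenRate_periodic (μ := μ) hp).intervalIntegral_add_eq s 0
  rw [zero_add] at h
  simp only [eigenFun]
  rw [← intervalIntegral.integral_add_adjacent_intervals (hi 0 s) (hi s (s + T)), h,
    Complex.exp_add]

theorem eigenFun_nat_mul (hk : IsStressFree C E k k') (hμ : charPoly C E μ = 0) {T : ℝ}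
    (hp : Function.Periodic k T) (n : ℕ) :
    eigenFun k k' μ (n * T) = eigenFun k k' μ T ^ n := by
  induction n with
  | zero => simp [eigenFun_zero]
  | succ n ih => rw [Nat.cast_succ, add_one_mul, hk.eigenFun_add hμ hp, ih, pow_succ]

theorem eigenFun_periodic (hk : IsStressFree C E k k') (hμ : charPoly C E μ = 0) {T : ℝ}
    (hp : Function.Periodic k T) (h1 : eigenFun k k' μ T = 1) :
    Function.Periodic (eigenFun k k' μ) T := fun s => by
  rw [hk.eigenFun_add hμ hp, h1, mul_one]

/-- The squared multiplier of an eigenfunction. -/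
theorem eigenFun_sq (hk : IsStressFree C E k k') (hμ : charPoly C E μ = 0) {T : ℝ}
    (hp : Function.Periodic k T) :
    eigenFun k k' μ T ^ 2 =
      Complex.exp (6 * Complex.I * ∫ t in (0 : ℝ)..T, (affineCurv k μ t)⁻¹) := by
  have hx := hk.affineCurv_ne_zero hμ
  have hc : Continuous fun t => (affineCurv k μ t)⁻¹ := hk.continuous_affineCurv.inv₀ hx
  -- Dividing the square by `3μ + 2k` cancels the `k'` term of its logarithmic derivative, leaving
  -- `6i / (3μ + 2k)`; the quotient by the corresponding exponential is constant.
  have hd : ∀ s, HasDerivAt (fun s => eigenFun k k' μ s ^ 2 * (affineCurv k μ s)⁻¹ *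
      Complex.exp (-(6 * Complex.I * ∫ t in (0 : ℝ)..s, (affineCurv k μ t)⁻¹))) 0 s := fun s => by
    have h := (((hk.hasDerivAt_eigenFun hμ s).pow 2).mul
      ((hk.hasDerivAt_affineCurv (μ := μ) s).inv (hx s))).mul
      ((((hc.integral_hasStrictDerivAt 0 s).hasDerivAt).const_mul (6 * Complex.I)).neg.cexp)
    refine h.congr_deriv ?_
    have hxs := hx s
    simp only [Pi.mul_apply, Pi.pow_apply, Pi.inv_apply, Pi.neg_apply, eigenRate]
    field_simp
    push_cast
    ring
  have h := eq_of_hasDerivAt_zero hd T 0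
  have hxT : affineCurv k μ T = affineCurv k μ 0 := by
    have := hp 0
    rw [zero_add] at this
    simp [affineCurv, this]
  have hx0 := inv_ne_zero (hx 0)
  simp only [hxT, eigenFun_zero, intervalIntegral.integral_same, mul_zero, neg_zero,
    Complex.exp_zero, one_pow, mul_one, one_mul] at h
  rw [mul_right_comm, mul_eq_right₀ hx0, Complex.exp_neg, mul_inv_eq_one₀ (Complex.exp_ne_zero _)]
    at h
  exact h

end IsStressFree

/-! ### Periodicity of all solutions: nonreal, double and simple eigenvalues. -/

/-- Every solution of the structure equation is `T`-periodic. -/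
def AllPeriodic (k k' : ℝ → ℝ) (T : ℝ) : Prop :=
  ∀ u, IsSolution k k' u → Function.Periodic (u 0) T

/-- For a double root `μ` of the characteristic polynomial, the ratio of the generalized
eigenfunction to the eigenfunction. -/
def jordanRatio (k k' : ℝ → ℝ) (μ : ℂ) (s : ℝ) : ℂ :=
  ∫ t in (0 : ℝ)..s, -3 * eigenRate k k' μ t / affineCurv k μ t

/-- The 2-jet of the generalized eigenfunction. -/
def jordanJet (k k' : ℝ → ℝ) (μ : ℂ) : Fin 3 → ℝ → ℂ :=
  ![fun s => jordanRatio k k' μ s * eigenFun k k' μ s,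
    fun s => (eigenRate k k' μ s * jordanRatio k k' μ s -
      3 * eigenRate k k' μ s / affineCurv k μ s) * eigenFun k k' μ s,
    fun s => ((μ - 4 / 3 * k s) * jordanRatio k k' μ s + 1) * eigenFun k k' μ s]

namespace IsStressFree

variable {C E : ℝ} {k k' : ℝ → ℝ} {μ : ℂ}

/-- The multiplier of an eigenfunction with nonreal eigenvalue is nontrivial. -/
theorem eigenFun_ne_one (hk : IsStressFree C E k k') (hμ : charPoly C E μ = 0) (him : μ.im ≠ 0)
    {T : ℝ} (hT : 0 < T) (hp : Function.Periodic k T) : eigenFun k k' μ T ≠ 1 := by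
  intro h1
  have hx := hk.affineCurv_ne_zero hμ
  have hc : Continuous fun t => (affineCurv k μ t)⁻¹ := hk.continuous_affineCurv.inv₀ hx
  have hsq := hk.eigenFun_sq hμ hp
  rw [h1, one_pow] at hsq
  have hn := congrArg norm hsq
  rw [norm_one, Complex.norm_exp, eq_comm, Real.exp_eq_one_iff] at hn
  have him2 : (∫ t in (0 : ℝ)..T, (affineCurv k μ t)⁻¹).im = 0 := by
    simpa using hn
  have hcomm := Complex.imCLM.intervalIntegral_comp_comm
    (hc.intervalIntegrable (μ := MeasureTheory.volume) 0 T)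
  simp only [Complex.imCLM_apply, him2] at hcomm
  -- The imaginary part of `1 / (3μ + 2k)` has constant sign, opposite to that of `Im μ`, so its
  -- integral over a period cannot vanish.
  have hform : ∀ t, ((affineCurv k μ t)⁻¹).im =
      -(3 * μ.im) * (Complex.normSq (affineCurv k μ t))⁻¹ := fun t => by
    rw [Complex.inv_im]
    simp [affineCurv, div_eq_mul_inv]
  simp only [hform, intervalIntegral.integral_const_mul] at hcomm
  have hpos : 0 < ∫ t in (0 : ℝ)..T, (Complex.normSq (affineCurv k μ t))⁻¹ := by
    refine intervalIntegral.intervalIntegral_pos_of_pos ?_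
      (fun t => inv_pos.2 (Complex.normSq_pos.2 (hx t))) hT
    refine Continuous.intervalIntegrable ?_ 0 T
    exact (Complex.continuous_normSq.comp hk.continuous_affineCurv).inv₀
      fun t => (Complex.normSq_pos.2 (hx t)).ne'
  rcases mul_eq_zero.1 hcomm with h | h
  · exact him (by linarith)
  · exact hpos.ne' h

theorem hasDerivAt_jordanRatio (hk : IsStressFree C E k k') (hμ : charPoly C E μ = 0) (s : ℝ) :
    HasDerivAt (jordanRatio k k' μ) (-3 * eigenRate k k' μ s / affineCurv k μ s) s := by
  have hc : Continuous fun t => -3 * eigenRate k k' μ t / affineCurv k μ t :=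
    (continuous_const.mul (hk.continuous_eigenRate hμ)).div hk.continuous_affineCurv
      (hk.affineCurv_ne_zero hμ)
  exact (hc.integral_hasStrictDerivAt 0 s).hasDerivAt

/-- Formally this is the `μ`-derivative of the eigenfunction: the integrand of `jordanRatio` is
`∂/∂μ` of `eigenRate`, and `9μ² = C` says that the derivative of `charPoly` vanishes. -/
theorem isSolution_jordanJet (hk : IsStressFree C E k k') (hμ : charPoly C E μ = 0)
    (hμ' : 9 * μ ^ 2 = C) : IsSolution k k' (jordanJet k k' μ) where
  d0 s := by
    refine ((hk.hasDerivAt_jordanRatio hμ s).mul (hk.hasDerivAt_eigenFun hμ s)).congr_deriv ?_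
    simp only [jordanJet, Matrix.cons_val]
    ring
  d1 s := by
    have hx := hk.affineCurv_ne_zero hμ s
    have hr := hk.hasDerivAt_eigenRate hμ s
    have h := (((hr.mul (hk.hasDerivAt_jordanRatio hμ s)).sub
      ((hr.const_mul 3).div (hk.hasDerivAt_affineCurv (μ := μ) s) hx))).mul
      (hk.hasDerivAt_eigenFun hμ s)
    refine h.congr_deriv ?_
    have he := hk.energyC s
    have hI := Complex.I_sq
    simp only [jordanJet, Matrix.cons_val, Pi.sub_apply, Pi.mul_apply, Pi.div_apply]
    generalize jordanRatio k k' μ s = J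
    generalize eigenFun k k' μ s = f
    simp only [eigenRate]
    field_simp
    simp only [affineCurv, charPoly] at *
    linear_combination 9 * f * he + 9 * f * hμ - (27 * μ + 18 * k s) * f * hμ' - 81 * f * hI
  d2 s := by
    have hx := hk.affineCurv_ne_zero hμ s
    have h := (((((hk.hasDerivAtC s).const_mul (4 / 3)).const_sub μ).mul
      (hk.hasDerivAt_jordanRatio hμ s)).add_const 1).mul (hk.hasDerivAt_eigenFun hμ s)
    refine h.congr_deriv ?_
    simp only [jordanJet, Matrix.cons_val, Pi.mul_apply, eigenRate]
    field_simp
    simp only [affineCurv]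
    ring

/-- The generalized eigenfunction at a real double root is not periodic. -/
theorem jordanJet_not_periodic (hk : IsStressFree C E k k') {ν : ℝ} (hμ : charPoly C E ν = 0)
    {T : ℝ} (hT : 0 < T) : ¬ Function.Periodic (jordanJet k k' ν 0) T := by
  intro hper
  have h0 := hper 0
  simp only [jordanJet, Matrix.cons_val, zero_add] at h0
  have hJ : jordanRatio k k' ν T = 0 := by
    have hz : jordanRatio k k' ν 0 = 0 := by simp [jordanRatio]
    rw [hz, zero_mul, mul_eq_zero] at h0
    exact h0.resolve_right (eigenFun_ne_zero T)
  have hx := hk.affineCurv_ne_zero hμ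
  have hxr : ∀ t, affineCurv k ν t = ((3 * ν + 2 * k t : ℝ) : ℂ) := fun t => by
    simp [affineCurv]
  have hx0 : ∀ t, 3 * ν + 2 * k t ≠ 0 := fun t h => hx t (by rw [hxr, h]; simp)
  have hc : Continuous fun t => -3 * eigenRate k k' ν t / affineCurv k ν t :=
    (continuous_const.mul (hk.continuous_eigenRate hμ)).div hk.continuous_affineCurv hx
  have hcomm := Complex.imCLM.intervalIntegral_comp_comm
    (hc.intervalIntegrable (μ := MeasureTheory.volume) 0 T)
  rw [jordanRatio] at hJ
  rw [hJ] at hcomm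
  -- For real `ν` only the constant `3i` in `k' + 3i` contributes to the imaginary part, which is
  -- strictly negative; the ratio cannot return to `0`.
  have hform : ∀ t, (-3 * eigenRate k k' ν t / affineCurv k ν t).im =
      -9 * ((3 * ν + 2 * k t) ^ 2)⁻¹ := fun t => by
    have : -3 * eigenRate k k' ν t / affineCurv k ν t =
        ((-3 * k' t * ((3 * ν + 2 * k t) ^ 2)⁻¹ : ℝ) : ℂ) +
          ((-9 * ((3 * ν + 2 * k t) ^ 2)⁻¹ : ℝ) : ℂ) * Complex.I := by
      have := hx t
      rw [hxr] at this
      rw [eigenRate, hxr]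
      push_cast at this ⊢
      field_simp
      ring
    rw [this, Complex.add_im, Complex.ofReal_im, Complex.im_ofReal_mul, Complex.I_im]
    ring
  simp only [Complex.imCLM_apply, hform, intervalIntegral.integral_const_mul,
    Complex.zero_im] at hcomm
  have hpos : 0 < ∫ t in (0 : ℝ)..T, ((3 * ν + 2 * k t) ^ 2)⁻¹ := by
    refine intervalIntegral.intervalIntegral_pos_of_pos ?_
      (fun t => inv_pos.2 (by have := hx0 t; positivity)) hT
    refine Continuous.intervalIntegrable ?_ 0 T
    exact ((continuous_const.add (continuous_const.mul hk.continuous_curv)).pow 2).inv₀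
      fun t => pow_ne_zero 2 (hx0 t)
  linarith

theorem wronskian_eigenJet (hk : IsStressFree C E k k') {μ₁ μ₂ μ₃ : ℂ}
    (h₁ : charPoly C E μ₁ = 0) (h₂ : charPoly C E μ₂ = 0) (h₃ : charPoly C E μ₃ = 0) (s : ℝ) :
    wronskian (eigenJet k k' μ₁) (eigenJet k k' μ₂) (eigenJet k k' μ₃) s =
      -9 * (k' s + 3 * Complex.I) * ((μ₁ - μ₂) * (μ₂ - μ₃) * (μ₃ - μ₁)) /
        (affineCurv k μ₁ s * affineCurv k μ₂ s * affineCurv k μ₃ s) *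
        (eigenFun k k' μ₁ s * eigenFun k k' μ₂ s * eigenFun k k' μ₃ s) := by
  have e₁ := hk.affineCurv_ne_zero h₁ s
  have e₂ := hk.affineCurv_ne_zero h₂ s
  have e₃ := hk.affineCurv_ne_zero h₃ s
  simp only [wronskian, eigenJet, Matrix.cons_val, eigenRate]
  field_simp
  simp only [affineCurv]
  ring

theorem wronskian_eigenJet_ne_zero (hk : IsStressFree C E k k') {μ₁ μ₂ μ₃ : ℂ}
    (h₁ : charPoly C E μ₁ = 0) (h₂ : charPoly C E μ₂ = 0) (h₃ : charPoly C E μ₃ = 0)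
    (h₁₂ : μ₁ ≠ μ₂) (h₂₃ : μ₂ ≠ μ₃) (h₃₁ : μ₃ ≠ μ₁) (s : ℝ) :
    wronskian (eigenJet k k' μ₁) (eigenJet k k' μ₂) (eigenJet k k' μ₃) s ≠ 0 := by
  rw [hk.wronskian_eigenJet h₁ h₂ h₃]
  have hk0 : (k' s : ℂ) + 3 * Complex.I ≠ 0 := fun h => by
    simpa using congrArg Complex.im h
  have e₁ := hk.affineCurv_ne_zero h₁ s
  have e₂ := hk.affineCurv_ne_zero h₂ s
  have e₃ := hk.affineCurv_ne_zero h₃ s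
  exact mul_ne_zero (div_ne_zero (mul_ne_zero (mul_ne_zero (by norm_num) hk0)
    (mul_ne_zero (mul_ne_zero (sub_ne_zero.2 h₁₂) (sub_ne_zero.2 h₂₃)) (sub_ne_zero.2 h₃₁)))
    (mul_ne_zero (mul_ne_zero e₁ e₂) e₃)) (mul_ne_zero (mul_ne_zero (eigenFun_ne_zero s)
    (eigenFun_ne_zero s)) (eigenFun_ne_zero s))

/-- If two of three multipliers are trivial, then so is the third, and all solutions are
periodic. -/
theorem allPeriodic (hk : IsStressFree C E k k') {μ₁ μ₂ μ₃ : ℂ}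
    (h₁ : charPoly C E μ₁ = 0) (h₂ : charPoly C E μ₂ = 0) (h₃ : charPoly C E μ₃ = 0)
    (h₁₂ : μ₁ ≠ μ₂) (h₂₃ : μ₂ ≠ μ₃) (h₃₁ : μ₃ ≠ μ₁) {T : ℝ} (hp : Function.Periodic k T)
    (p₂ : eigenFun k k' μ₂ T = 1) (p₃ : eigenFun k k' μ₃ T = 1) : AllPeriodic k k' T := by
  have s₁ := hk.isSolution_eigenJet h₁
  have s₂ := hk.isSolution_eigenJet h₂
  have s₃ := hk.isSolution_eigenJet h₃
  have hw := hk.wronskian_eigenJet_ne_zero h₁ h₂ h₃ h₁₂ h₂₃ h₃₁ 0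
  have p₁ : eigenFun k k' μ₁ T = 1 := by
    -- Rates and curvature return to their initial values at `T`, so the Wronskian there is the
    -- product of the three multipliers times its value at `0`.
    have hc := wronskian_const s₁ s₂ s₃ T 0
    have hrate := fun μ => hk.eigenRate_periodic (μ := μ) hp 0
    have hk0 := hp 0
    simp only [zero_add] at hrate hk0
    apply mul_left_cancel₀ hw
    rw [mul_one]
    refine Eq.trans ?_ hc
    simp only [wronskian, eigenJet, Matrix.cons_val, hrate, hk0, p₂, p₃, eigenFun_zero]
    ring
  intro u hu
  exact s₁.periodic s₂ s₃ hu hw (hk.eigenFun_periodic h₁ hp p₁) (hk.eigenFun_periodic h₂ hp p₂)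
    (hk.eigenFun_periodic h₃ hp p₃)

end IsStressFree

/-! ### Multipliers over one wavelength in terms of `Θ`. -/

/-- The energy constant of `κ_{m,ℓ}`. -/
def modelC (m ℓ : ℝ) : ℝ := (m ^ 2 - m + 1) * ℓ ^ 4

/-- The second energy constant of `κ_{m,ℓ}`. -/
def modelE (m ℓ : ℝ) : ℝ := -((m + 1) * (2 * m - 1) * (m - 2) * ℓ ^ 6 / 3)

theorem isStressFree_modelCurvature {m : ℝ} (hm0 : 0 < m) (hm1 : m < 1) (ℓ : ℝ) :
    IsStressFree (modelC m ℓ) (modelE m ℓ) (modelCurvature m ℓ) (modelCurvatureDeriv m ℓ) where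
  hasDerivAt := hasDerivAt_modelCurvature hm0 hm1 ℓ
  hasDerivAt' := hasDerivAt_modelCurvatureDeriv hm0 hm1 ℓ
  energy := modelCurvature_energy hm0 hm1 ℓ

/-- The integral of `1 / (3 μ + 2 κ)` over one wavelength. -/
theorem integral_inv_affineCurv {m ℓ : ℝ} (hm0 : 0 < m) (hm1 : m < 1) (hℓ : 0 < ℓ) {lam : ℝ}
    (hlam : charPoly (modelC m ℓ) (modelE m ℓ) ((lam / 2 : ℝ) : ℂ) = 0) :
    ∫ t in (0 : ℝ)..wavelength m ℓ, (affineCurv (modelCurvature m ℓ) ((lam / 2 : ℝ) : ℂ) t)⁻¹ =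
      ((2 * Real.pi / 3 * periodOf m ℓ lam : ℝ) : ℂ) := by
  have hk := isStressFree_modelCurvature hm0 hm1 ℓ
  have hx := hk.affineCurv_ne_zero hlam
  set N : ℝ := 2 * (1 + m) * ℓ ^ 2 + 3 * lam with hN
  have hxr : ∀ t, affineCurv (modelCurvature m ℓ) ((lam / 2 : ℝ) : ℂ) t =
      (((N - 6 * m * ℓ ^ 2 * jacobiSn (ℓ * t) m ^ 2) / 2 : ℝ) : ℂ) := fun t => by
    rw [affineCurv, modelCurvature, hN]
    push_cast
    ring
  have hne : ∀ θ, N - 6 * m * ℓ ^ 2 * Real.sin θ ^ 2 ≠ 0 := fun θ h => by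
    apply hx (ellipticF m θ / ℓ)
    rw [hxr, jacobiSn, mul_div_cancel₀ _ hℓ.ne', jacobiAm_ellipticF hm0 hm1, h]
    simp
  have hN0 : N ≠ 0 := by simpa using hne 0
  have hsub := integral_comp_jacobiAm hm0 hm1 hℓ
    (fun y => ((N - 6 * m * ℓ ^ 2 * y) / 2)⁻¹) (by
      refine Continuous.inv₀ (by fun_prop) fun θ => ?_
      exact div_ne_zero (hne θ) two_ne_zero)
  simp only [hxr, ← Complex.ofReal_inv]
  rw [intervalIntegral.integral_ofReal, hsub]
  have hform : ∀ θ, ((N - 6 * m * ℓ ^ 2 * Real.sin θ ^ 2) / 2)⁻¹ *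
      (1 / Real.sqrt (1 - m * Real.sin θ ^ 2)) = 2 / N *
      (1 / ((1 - 6 * m * ℓ ^ 2 / N * Real.sin θ ^ 2) * Real.sqrt (1 - m * Real.sin θ ^ 2))) := by
    intro θ
    have h1 := hne θ
    have h2 := (Real.sqrt_pos.2 (one_sub_mul_sin_sq_pos hm0 hm1 θ)).ne'
    have h3 : 1 - 6 * m * ℓ ^ 2 / N * Real.sin θ ^ 2 =
        (N - 6 * m * ℓ ^ 2 * Real.sin θ ^ 2) / N := by field_simp
    rw [h3]
    field_simp
  simp only [hform, intervalIntegral.integral_const_mul]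
  rw [periodOf, ellipticPi, ← hN]
  have := Real.pi_ne_zero
  congr 1
  field_simp
  ring

theorem eigenFun_sq_wavelength {m ℓ : ℝ} (hm0 : 0 < m) (hm1 : m < 1) (hℓ : 0 < ℓ) {lam : ℝ}
    (hlam : charPoly (modelC m ℓ) (modelE m ℓ) ((lam / 2 : ℝ) : ℂ) = 0) :
    eigenFun (modelCurvature m ℓ) (modelCurvatureDeriv m ℓ) ((lam / 2 : ℝ) : ℂ)
      (wavelength m ℓ) ^ 2 = Complex.exp (2 * periodOf m ℓ lam * (2 * Real.pi * Complex.I)) := by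
  rw [(isStressFree_modelCurvature hm0 hm1 ℓ).eigenFun_sq hlam
    (periodic_modelCurvature hm0 hm1 hℓ), integral_inv_affineCurv hm0 hm1 hℓ hlam]
  congr 1
  push_cast
  ring

/-- Squaring the multiplier loses nothing here: `exp (4πinΘ) = 1` already makes `2nΘ` an integer. -/
theorem rational_of_eigenFun_pow {m ℓ : ℝ} (hm0 : 0 < m) (hm1 : m < 1) (hℓ : 0 < ℓ) {lam : ℝ}
    (hlam : charPoly (modelC m ℓ) (modelE m ℓ) ((lam / 2 : ℝ) : ℂ) = 0) {n : ℕ} (hn : 0 < n)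
    (h : eigenFun (modelCurvature m ℓ) (modelCurvatureDeriv m ℓ) ((lam / 2 : ℝ) : ℂ)
      (wavelength m ℓ) ^ n = 1) : ∃ q : ℚ, periodOf m ℓ lam = q := by
  have h2 : (Complex.exp (2 * periodOf m ℓ lam * (2 * Real.pi * Complex.I))) ^ n = 1 := by
    rw [← eigenFun_sq_wavelength hm0 hm1 hℓ hlam, ← pow_mul, mul_comm, pow_mul, h, one_pow]
  rw [← Complex.exp_nat_mul, Complex.exp_eq_one_iff] at h2
  obtain ⟨N, hN⟩ := h2
  rw [← mul_assoc] at hN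
  have h3 := mul_right_cancel₀ Complex.two_pi_I_ne_zero hN
  have h4 : (n : ℝ) * (2 * periodOf m ℓ lam) = N := by exact_mod_cast h3
  refine ⟨N / (2 * n), ?_⟩
  have : (n : ℝ) ≠ 0 := by positivity
  push_cast
  field_simp
  linarith

theorem eigenFun_pow_of_rational {m ℓ : ℝ} (hm0 : 0 < m) (hm1 : m < 1) (hℓ : 0 < ℓ) {lam : ℝ}
    (hlam : charPoly (modelC m ℓ) (modelE m ℓ) ((lam / 2 : ℝ) : ℂ) = 0) {q : ℚ}
    (hq : periodOf m ℓ lam = q) :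
    eigenFun (modelCurvature m ℓ) (modelCurvatureDeriv m ℓ) ((lam / 2 : ℝ) : ℂ)
      (wavelength m ℓ) ^ (2 * q.den) = 1 := by
  rw [pow_mul, eigenFun_sq_wavelength hm0 hm1 hℓ hlam, ← Complex.exp_nat_mul,
    Complex.exp_eq_one_iff]
  refine ⟨2 * q.num, ?_⟩
  have h : (q.den : ℂ) * q = q.num := by
    exact_mod_cast q.den_mul_eq_num
  rw [hq]
  push_cast
  linear_combination (4 * Real.pi * Complex.I : ℂ) * h

/-! ### The cubic of eigenvalues: discriminant and trigonometric roots. -/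

/-- A real cubic whose discriminant is not positive has a nonreal root or a real double root. -/
theorem exists_nonreal_or_double_root {P S : ℝ} (h : -4 * P ^ 3 - 27 * S ^ 2 ≤ 0) :
    (∃ z : ℂ, z ^ 3 + P * z + S = 0 ∧ z.im ≠ 0) ∨
      ∃ r : ℝ, r ^ 3 + P * r + S = 0 ∧ 3 * r ^ 2 + P = 0 := by
  obtain ⟨z, hz⟩ : ∃ z : ℂ, z ^ 3 + P * z + S = 0 := by
    have hdeg : (Cubic.toPoly ⟨(1 : ℂ), 0, P, S⟩).degree = 3 :=
      Cubic.degree_of_a_ne_zero one_ne_zero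
    obtain ⟨z, hz⟩ := IsAlgClosed.exists_root (Cubic.toPoly ⟨(1 : ℂ), 0, P, S⟩)
      (by rw [hdeg]; norm_num)
    exact ⟨z, by simpa [Cubic.toPoly, Polynomial.IsRoot] using hz⟩
  by_cases him : z.im = 0
  swap
  · exact Or.inl ⟨z, hz, him⟩
  have hzr : z = (z.re : ℂ) := Complex.ext rfl (by simpa using him)
  set r := z.re
  rw [hzr] at hz
  have hr : r ^ 3 + P * r + S = 0 := by exact_mod_cast hz
  -- The first factor is the discriminant of the quadratic quotient `t² + rt + r² + P`, and `3r² +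
  -- P` is the value of that quotient at `r`. Its sign separates a conjugate pair, a double root
  -- `-r/2`, and `r` itself double.
  have hfac : -4 * P ^ 3 - 27 * S ^ 2 = (-3 * r ^ 2 - 4 * P) * (3 * r ^ 2 + P) ^ 2 := by
    have : S = -(r ^ 3 + P * r) := by linarith
    rw [this]; ring
  rcases lt_trichotomy (-3 * r ^ 2 - 4 * P) 0 with hd | hd | hd
  · left
    set q := Real.sqrt (3 * r ^ 2 + 4 * P)
    have hq : q ^ 2 = 3 * r ^ 2 + 4 * P := Real.sq_sqrt (by linarith)
    have hq0 : q ≠ 0 := (Real.sqrt_pos.2 (by linarith)).ne'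
    refine ⟨((-r / 2 : ℝ) : ℂ) + ((q / 2 : ℝ) : ℂ) * Complex.I, ?_, by simpa using hq0⟩
    have hqc : (q : ℂ) ^ 2 = 3 * r ^ 2 + 4 * P := by exact_mod_cast hq
    have hS : (S : ℂ) = -(r ^ 3 + P * r) := by
      have : S = -(r ^ 3 + P * r) := by linarith
      rw [this]; push_cast; ring
    have hI := Complex.I_sq
    have hI3 : Complex.I ^ 3 = -Complex.I := Complex.I_pow_three
    rw [hS]
    push_cast
    ring_nf
    rw [hI3, hI, show (q : ℂ) ^ 3 = q * q ^ 2 by ring, hqc]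
    ring
  · right
    by_cases hr0 : 3 * r ^ 2 + P = 0
    · exact ⟨r, hr, hr0⟩
    · refine ⟨-r / 2, ?_, by linarith⟩
      have : P = -3 / 4 * r ^ 2 := by linarith
      rw [this] at hr ⊢
      linarith
  · right
    have : (3 * r ^ 2 + P) ^ 2 ≤ 0 := by
      by_contra hcon
      push Not at hcon
      have := mul_pos hd hcon
      linarith
    exact ⟨r, hr, by simpa using le_antisymm this (sq_nonneg _)⟩

/-- `p(m, ℓ)` is the discriminant of the characteristic polynomial of the momentum. -/
theorem momentumDiscr_eq (m ℓ : ℝ) : momentumDiscr m ℓ =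
    -4 * (-(4 / 3 * modelC m ℓ)) ^ 3 - 27 * (8 / 9 * (modelE m ℓ + 9)) ^ 2 := by
  rw [momentumDiscr, modelC, modelE]
  ring

theorem charPoly_half (C E : ℝ) (z : ℂ) : charPoly C E (z / 2) =
    9 / 8 * (z ^ 3 + (-(4 / 3 * C) : ℝ) * z + (8 / 9 * (E + 9) : ℝ)) := by
  rw [charPoly]
  push_cast
  ring

theorem momentumDiscr_pos_of_allPeriodic {m ℓ T : ℝ} (hm0 : 0 < m) (hm1 : m < 1) (hT : 0 < T)
    (hp : Function.Periodic (modelCurvature m ℓ) T)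
    (h : AllPeriodic (modelCurvature m ℓ) (modelCurvatureDeriv m ℓ) T) :
    0 < momentumDiscr m ℓ := by
  have hk := isStressFree_modelCurvature hm0 hm1 ℓ
  by_contra hcon
  push Not at hcon
  rw [momentumDiscr_eq] at hcon
  rcases exists_nonreal_or_double_root hcon with ⟨z, hz, him⟩ | ⟨r, hr, hr'⟩
  · have hroot : charPoly (modelC m ℓ) (modelE m ℓ) (z / 2) = 0 := by
      rw [charPoly_half, hz, mul_zero]
    have hper := h _ (hk.isSolution_eigenJet hroot) 0
    have him2 : (z / 2).im ≠ 0 := by simpa using him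
    apply hk.eigenFun_ne_one hroot him2 hT hp
    simpa [eigenJet, IsStressFree.eigenFun_zero] using hper
  · have hroot : charPoly (modelC m ℓ) (modelE m ℓ) ((r / 2 : ℝ) : ℂ) = 0 := by
      rw [Complex.ofReal_div, Complex.ofReal_ofNat, charPoly_half]
      have : (r : ℂ) ^ 3 + (-(4 / 3 * modelC m ℓ) : ℝ) * r + (8 / 9 * (modelE m ℓ + 9) : ℝ) = 0 := by
        exact_mod_cast hr
      rw [this, mul_zero]
    have hdouble : 9 * (((r / 2 : ℝ) : ℂ)) ^ 2 = modelC m ℓ := by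
      have : 9 * (r / 2) ^ 2 = modelC m ℓ := by linarith
      exact_mod_cast this
    exact hk.jordanJet_not_periodic hroot hT (h _ (hk.isSolution_jordanJet hroot hdouble))

/-- The eigenvalues of the momentum in trigonometric form. -/
theorem charPoly_sin {m ℓ : ℝ} (hℓ : 0 < ℓ) {β : ℝ}
    (hβ : Real.sin (3 * β) = momentumAux m ℓ) :
    charPoly (modelC m ℓ) (modelE m ℓ)
      ((-(4 / 3 * Real.sqrt (1 + m * (m - 1)) * ℓ ^ 2 * Real.sin β) / 2 : ℝ) : ℂ) = 0 := by
  have hD : 0 < 1 + m * (m - 1) := by nlinarith [sq_nonneg (2 * m - 1)]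
  rw [Complex.ofReal_div, Complex.ofReal_ofNat, charPoly_half]
  set d := Real.sqrt (1 + m * (m - 1)) with hd
  have hd2 : d ^ 2 = 1 + m * (m - 1) := Real.sq_sqrt hD.le
  have hd0 : 0 < d := Real.sqrt_pos.2 hD
  have hd3 : (1 + (m - 1) * m) ^ (3 / 2 : ℝ) = d ^ 3 := by
    rw [mul_comm (m - 1) m, hd, Real.sqrt_eq_rpow, ← Real.rpow_natCast, ← Real.rpow_mul hD.le]
    norm_num
  rw [momentumAux, hd3, Real.sin_three_mul, eq_div_iff (by positivity)] at hβ
  -- Viète's substitution: the amplitude `(4/3) d ℓ²` turns the cubic into `3 sin β - 4 sin³ β = sin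
  -- 3β`.
  have key : (-(4 / 3 * d * ℓ ^ 2 * Real.sin β)) ^ 3 + -(4 / 3 * modelC m ℓ) *
      (-(4 / 3 * d * ℓ ^ 2 * Real.sin β)) + 8 / 9 * (modelE m ℓ + 9) = 0 := by
    rw [modelC, modelE, show m ^ 2 - m + 1 = d ^ 2 by rw [hd2]; ring]
    linear_combination (8 / 27 : ℝ) * hβ
  have keyC : ((-(4 / 3 * d * ℓ ^ 2 * Real.sin β) : ℝ) : ℂ) ^ 3 + (-(4 / 3 * modelC m ℓ) : ℝ) *
      ((-(4 / 3 * d * ℓ ^ 2 * Real.sin β) : ℝ) : ℂ) + (8 / 9 * (modelE m ℓ + 9) : ℝ) = 0 := by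
    exact_mod_cast key
  rw [keyC, mul_zero]

/-- The squared denominator minus the squared numerator of `p̃` is `(27/64) p`, because `4(1 - m +
m²)³ - ((m-2)(1+m)(2m-1))² = 27m²(m-1)²`. -/
theorem momentumAux_abs_lt_one {m ℓ : ℝ} (hℓ : 0 < ℓ) (hp : 0 < momentumDiscr m ℓ) :
    |momentumAux m ℓ| < 1 := by
  have hD : 0 < 1 + (m - 1) * m := by nlinarith [sq_nonneg (2 * m - 1)]
  have hD3 : ((1 + (m - 1) * m) ^ (3 / 2 : ℝ)) ^ 2 = (1 + (m - 1) * m) ^ 3 := by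
    rw [← Real.rpow_natCast, ← Real.rpow_mul hD.le, ← Real.rpow_natCast]
    norm_num
  have hpos : 0 < (1 + (m - 1) * m) ^ (3 / 2 : ℝ) := Real.rpow_pos_of_pos hD _
  rw [← sq_lt_one_iff_abs_lt_one, momentumAux, div_pow, div_lt_one (by positivity), mul_pow,
    mul_pow, hD3]
  rw [momentumDiscr] at hp
  nlinarith

/-- Three distinct real roots of the characteristic polynomial, when `p(m, ℓ) > 0`. -/
theorem exists_roots_of_momentumDiscr_pos {m ℓ : ℝ} (hℓ : 0 < ℓ) (hp : 0 < momentumDiscr m ℓ) :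
    ∃ l₁ : ℝ, charPoly (modelC m ℓ) (modelE m ℓ) ((l₁ / 2 : ℝ) : ℂ) = 0 ∧
      charPoly (modelC m ℓ) (modelE m ℓ) ((eigenvalue₂ m ℓ / 2 : ℝ) : ℂ) = 0 ∧
      charPoly (modelC m ℓ) (modelE m ℓ) ((eigenvalue₃ m ℓ / 2 : ℝ) : ℂ) = 0 ∧
      l₁ ≠ eigenvalue₂ m ℓ ∧ eigenvalue₂ m ℓ ≠ eigenvalue₃ m ℓ ∧ eigenvalue₃ m ℓ ≠ l₁ := by
  have habs := abs_lt.1 (momentumAux_abs_lt_one hℓ hp)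
  have hsin := Real.sin_arcsin habs.1.le habs.2.le
  set α := Real.arcsin (momentumAux m ℓ) / 3 with hα
  have h3α : 3 * α = Real.arcsin (momentumAux m ℓ) := by rw [hα]; ring
  have hD : 0 < 1 + m * (m - 1) := by nlinarith [sq_nonneg (2 * m - 1)]
  have hd : 0 < Real.sqrt (1 + m * (m - 1)) := Real.sqrt_pos.2 hD
  have hsc := Real.sin_sq_add_cos_sq α
  have h3sq : Real.sqrt 3 ^ 2 = 3 := Real.sq_sqrt (by norm_num)
  have h30 : 0 < Real.sqrt 3 := Real.sqrt_pos.2 (by norm_num)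
  have hsin3 : Real.sin (3 * α) = momentumAux m ℓ := by rw [h3α, hsin]
  -- Strictness of `|p̃| < 1` enters here. Both factors of `cos 3α = cos α (1 - 4 sin² α)` are then
  -- nonzero, and these are what separate the three roots.
  have hcos3 : Real.cos (3 * α) ≠ 0 := by
    rw [h3α]
    rw [Real.cos_arcsin]
    exact (Real.sqrt_pos.2 (by nlinarith)).ne'
  have hcc : Real.cos α * (1 - 4 * Real.sin α ^ 2) ≠ 0 := by
    have : Real.cos (3 * α) = Real.cos α * (1 - 4 * Real.sin α ^ 2) := by
      rw [Real.cos_three_mul]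
      linear_combination (4 * Real.cos α) * hsc
    rwa [← this]
  obtain ⟨hc0, hs0⟩ := mul_ne_zero_iff.1 hcc
  have hs23 : Real.sin (2 * Real.pi / 3) = Real.sqrt 3 / 2 := by
    rw [show 2 * Real.pi / 3 = Real.pi - Real.pi / 3 by ring, Real.sin_pi_sub,
      Real.sin_pi_div_three]
  have hc23 : Real.cos (2 * Real.pi / 3) = -(1 / 2) := by
    rw [show 2 * Real.pi / 3 = Real.pi - Real.pi / 3 by ring, Real.cos_pi_sub,
      Real.cos_pi_div_three]
  -- The three angles with the same `sin 3β` are `α` and `α ± 2π/3`; `λ₂` belongs to `α` and `λ₃` to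
  -- `α - 2π/3`.
  have r₁ := charPoly_sin (m := m) hℓ (β := α + 2 * Real.pi / 3) (by
    rw [show 3 * (α + 2 * Real.pi / 3) = 3 * α + 2 * Real.pi by ring, Real.sin_add_two_pi, hsin3])
  have r₂ := charPoly_sin (m := m) hℓ hsin3
  have r₃ := charPoly_sin (m := m) hℓ (β := α - 2 * Real.pi / 3) (by
    rw [show 3 * (α - 2 * Real.pi / 3) = 3 * α - 2 * Real.pi by ring, Real.sin_sub_two_pi, hsin3])
  rw [Real.sin_add, hs23, hc23] at r₁
  rw [Real.sin_sub, hs23, hc23] at r₃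
  have e₂ : eigenvalue₂ m ℓ =
      -(4 / 3 * Real.sqrt (1 + m * (m - 1)) * ℓ ^ 2 * Real.sin α) := by
    rw [eigenvalue₂]; ring
  have e₃ : eigenvalue₃ m ℓ = -(4 / 3 * Real.sqrt (1 + m * (m - 1)) * ℓ ^ 2 *
      (Real.sin α * -(1 / 2) - Real.cos α * (Real.sqrt 3 / 2))) := by
    rw [eigenvalue₃, ← hα]
    field_simp
    linear_combination (-4 * Real.cos α) * h3sq
  rw [← e₂] at r₂
  rw [← e₃] at r₃
  have hρ : 4 / 3 * Real.sqrt (1 + m * (m - 1)) * ℓ ^ 2 ≠ 0 := by positivity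
  refine ⟨_, r₁, r₂, r₃, ?_, ?_, ?_⟩
  · rw [e₂]
    intro h
    have h2 := mul_left_cancel₀ hρ (neg_injective h)
    have h3 : Real.cos α * Real.sqrt 3 = 3 * Real.sin α := by linarith
    apply hs0
    have h4 : (Real.cos α * Real.sqrt 3) ^ 2 = (3 * Real.sin α) ^ 2 := by rw [h3]
    rw [mul_pow, h3sq] at h4
    linarith
  · rw [e₂, e₃]
    intro h
    have h2 := mul_left_cancel₀ hρ (neg_injective h)
    have h3 : Real.cos α * Real.sqrt 3 = -3 * Real.sin α := by linarith
    apply hs0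
    have h4 : (Real.cos α * Real.sqrt 3) ^ 2 = (-3 * Real.sin α) ^ 2 := by rw [h3]
    rw [mul_pow, h3sq] at h4
    linarith
  · rw [e₃]
    intro h
    have h2 := mul_left_cancel₀ hρ (neg_injective h)
    have h3 : Real.cos α * Real.sqrt 3 = 0 := by linarith
    exact (mul_ne_zero hc0 h30.ne') h3

/-! ### The closing condition for the linear equation. -/

/-- Closing condition for the structure equation with curvature `κ_{m,ℓ}`. -/
theorem exists_allPeriodic_iff {m ℓ : ℝ} (hm0 : 0 < m) (hm1 : m < 1) (hℓ : 0 < ℓ) :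
    (∃ n : ℕ, 0 < n ∧ AllPeriodic (modelCurvature m ℓ) (modelCurvatureDeriv m ℓ)
      (n * wavelength m ℓ)) ↔
      0 < momentumDiscr m ℓ ∧ (∃ q : ℚ, Theta₂ m ℓ = (q : ℝ)) ∧ ∃ q : ℚ, Theta₃ m ℓ = (q : ℝ) := by
  have hk := isStressFree_modelCurvature hm0 hm1 ℓ
  have hper := periodic_modelCurvature hm0 hm1 hℓ
  constructor
  · rintro ⟨n, hn, hall⟩
    have hnT : 0 < n * wavelength m ℓ :=
      mul_pos (Nat.cast_pos.2 hn) (wavelength_pos hm0 hm1 hℓ)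
    have hp := momentumDiscr_pos_of_allPeriodic hm0 hm1 hnT (hper.nat_mul n) hall
    obtain ⟨l₁, -, h₂, h₃, -⟩ := exists_roots_of_momentumDiscr_pos hℓ hp
    have key : ∀ lam : ℝ, charPoly (modelC m ℓ) (modelE m ℓ) ((lam / 2 : ℝ) : ℂ) = 0 →
        ∃ q : ℚ, periodOf m ℓ lam = q := fun lam hlam => by
      refine rational_of_eigenFun_pow hm0 hm1 hℓ hlam hn ?_
      have := hall _ (hk.isSolution_eigenJet hlam) 0
      rw [← hk.eigenFun_nat_mul hlam hper]
      simpa [eigenJet, IsStressFree.eigenFun_zero] using this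
    exact ⟨hp, key _ h₂, key _ h₃⟩
  · rintro ⟨hp, ⟨q₂, hq₂⟩, q₃, hq₃⟩
    obtain ⟨l₁, h₁, h₂, h₃, h₁₂, h₂₃, h₃₁⟩ := exists_roots_of_momentumDiscr_pos hℓ hp
    have inj : ∀ {a b : ℝ}, a ≠ b → ((a / 2 : ℝ) : ℂ) ≠ ((b / 2 : ℝ) : ℂ) := fun hab h =>
      hab (by have := Complex.ofReal_injective h; linarith)
    -- The factor `2` is needed because `Θ` controls only the square of a multiplier; the product of
    -- denominators serves both eigenvalues.
    refine ⟨2 * q₂.den * q₃.den, by have := q₂.den_pos; have := q₃.den_pos; positivity, ?_⟩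
    refine hk.allPeriodic h₁ h₂ h₃ (inj h₁₂) (inj h₂₃) (inj h₃₁) (hper.nat_mul _) ?_ ?_
    · rw [hk.eigenFun_nat_mul h₂ hper, pow_mul, eigenFun_pow_of_rational hm0 hm1 hℓ h₂ hq₂,
        one_pow]
    · rw [hk.eigenFun_nat_mul h₃ hper, mul_right_comm, pow_mul,
        eigenFun_pow_of_rational hm0 hm1 hℓ h₃ hq₃, one_pow]

/-! ### Algebra and differentiation of the pseudo-Hermitian product. -/

theorem star_herm (z w : Fin 3 → ℂ) : star (herm z w) = herm w z := by
  simp only [herm, star_add, star_mul', star_sub, Complex.star_def, Complex.conj_I,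
    Complex.conj_conj]
  ring

theorem herm_add_right (z v w : Fin 3 → ℂ) : herm z (v + w) = herm z v + herm z w := by
  simp only [herm, Pi.add_apply]
  ring

theorem herm_smul_right (c : ℂ) (z w : Fin 3 → ℂ) : herm z (c • w) = c * herm z w := by
  simp only [herm, Pi.smul_apply, smul_eq_mul]
  ring

theorem herm_smul_left (c : ℂ) (z w : Fin 3 → ℂ) : herm (c • z) w = star c * herm z w := by
  simp only [herm, Pi.smul_apply, smul_eq_mul, star_mul']
  ring

/-- The determinant of three row vectors. -/
def det3 (u v w : Fin 3 → ℂ) : ℂ := (Matrix.of ![u, v, w]).det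

theorem det3_eq (u v w : Fin 3 → ℂ) : det3 u v w = u 0 * (v 1 * w 2 - v 2 * w 1) -
    u 1 * (v 0 * w 2 - v 2 * w 0) + u 2 * (v 0 * w 1 - v 1 * w 0) := by
  simp [det3, Matrix.det_fin_three]
  ring

/-- The Gram determinant of the pseudo-Hermitian product. -/
theorem gram_det (u v w x y z : Fin 3 → ℂ) :
    herm u x * (herm v y * herm w z - herm v z * herm w y) -
      herm u y * (herm v x * herm w z - herm v z * herm w x) +
      herm u z * (herm v x * herm w y - herm v y * herm w x) =
      -(star (det3 u v w) * det3 x y z) := by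
  -- The sign is the determinant of the form's matrix. Written as `I ^ 2`, it makes the claim a
  -- polynomial identity with `I` as an indeterminate.
  have h : -(star (det3 u v w) * det3 x y z) = Complex.I ^ 2 * (star (det3 u v w) * det3 x y z) := by
    rw [Complex.I_sq]; ring
  rw [h]
  simp only [det3_eq, herm, star_add, star_mul', star_sub]
  ring

/-- A zero column in the Gram determinant gives `det3 x y z = 0` for all `y`, `z`; basis vectors
then read off the coordinates of `x`. -/
theorem eq_zero_of_herm_eq_zero {u v w x : Fin 3 → ℂ} (hd : det3 u v w ≠ 0) (hu : herm u x = 0)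
    (hv : herm v x = 0) (hw : herm w x = 0) : x = 0 := by
  have h : ∀ y z, det3 x y z = 0 := fun y z => by
    have := gram_det u v w x y z
    rw [hu, hv, hw] at this
    have h2 : star (det3 u v w) * det3 x y z = 0 := by linear_combination this
    exact (mul_eq_zero.1 h2).resolve_left (star_ne_zero.2 hd)
  have h0 := h ![0, 1, 0] ![0, 0, 1]
  have h1 := h ![1, 0, 0] ![0, 0, 1]
  have h2 := h ![1, 0, 0] ![0, 1, 0]
  simp [det3_eq] at h0 h1 h2
  ext j
  fin_cases j
  · exact h0
  · exact h1
  · exact h2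

theorem hasDerivAt_herm {f g : ℝ → Fin 3 → ℂ} {f' g' : Fin 3 → ℂ} {t : ℝ}
    (hf : HasDerivAt f f' t) (hg : HasDerivAt g g' t) :
    HasDerivAt (fun s => herm (f s) (g s)) (herm f' (g t) + herm (f t) g') t := by
  rw [hasDerivAt_pi] at hf hg
  have h := ((((hf 0).star.mul (hg 2)).sub ((hf 2).star.mul (hg 0))).const_mul Complex.I).add
    ((hf 1).star.mul (hg 1))
  refine h.congr_deriv ?_
  simp only [herm]
  ring

theorem hasDerivAt_det3 {f g h : ℝ → Fin 3 → ℂ} {f' g' h' : Fin 3 → ℂ} {t : ℝ}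
    (hf : HasDerivAt f f' t) (hg : HasDerivAt g g' t) (hh : HasDerivAt h h' t) :
    HasDerivAt (fun s => det3 (f s) (g s) (h s))
      (det3 f' (g t) (h t) + det3 (f t) g' (h t) + det3 (f t) (g t) h') t := by
  rw [hasDerivAt_pi] at hf hg hh
  simp only [det3_eq]
  refine ((((hf 0).mul (((hg 1).mul (hh 2)).sub ((hg 2).mul (hh 1)))).sub
    ((hf 1).mul (((hg 0).mul (hh 2)).sub ((hg 2).mul (hh 0))))).add
    ((hf 2).mul (((hg 0).mul (hh 1)).sub ((hg 1).mul (hh 0))))).congr_deriv ?_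
  simp only [Pi.sub_apply, Pi.mul_apply]
  ring

theorem hasDerivAt_iteratedDeriv {F : Type*} [NormedAddCommGroup F] [NormedSpace ℝ F] {f : ℝ → F}
    (hf : ContDiff ℝ ∞ f) (n : ℕ) (t : ℝ) :
    HasDerivAt (iteratedDeriv n f) (iteratedDeriv (n + 1) f t) t := by
  rw [iteratedDeriv_succ]
  exact (hf.differentiable_iteratedDeriv n (by exact_mod_cast ENat.natCast_lt_top n) t).hasDerivAt

/-! ### Normalized lifts, their structure equation and closedness. -/

variable {γ : ℝ → CP2} {G : ℝ → Fin 3 → ℂ}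

theorem exists_smul_eq_of_lift {v w : Fin 3 → ℂ} {hv : v ≠ 0} {hw : w ≠ 0}
    (h : Projectivization.mk ℂ v hv = Projectivization.mk ℂ w hw) : ∃ c : ℂ, c • w = v :=
  (Projectivization.mk_eq_mk_iff' ℂ v w hv hw).1 h

theorem herm_self_eq_zero (hγ : IsLegendrian γ) (hl : IsLiftOn γ G Set.univ) (t : ℝ) :
    herm (G t) (G t) = 0 := by
  obtain ⟨h, e⟩ := hl t (Set.mem_univ t)
  have := hγ.1 t
  rw [e] at this
  exact (mk_mem_quadric _ h).1 this

/-- The contact condition holds for every differentiable global lift. -/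
theorem herm_deriv_eq_zero (hγ : IsLegendrian γ) (hl : IsLiftOn γ G Set.univ) {t : ℝ}
    {G' : Fin 3 → ℂ} (hG : HasDerivAt G G' t) : herm (G t) G' = 0 := by
  obtain ⟨J, L, hJ, htJ, hL, hLl, -, hcontact⟩ := hγ.2 t
  have hLd : HasDerivAt L (deriv L t) t :=
    ((hL.contDiffAt (hJ.mem_nhds htJ)).differentiableAt (by simp)).hasDerivAt
  have hprop : ∀ s ∈ J, ∃ c : ℂ, c • L s = G s := fun s hs => by
    obtain ⟨h1, e1⟩ := hl s (Set.mem_univ s)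
    obtain ⟨h2, e2⟩ := hLl s hs
    exact exists_smul_eq_of_lift (e1.symm.trans e2)
  obtain ⟨hL0, eL⟩ := hLl t htJ
  obtain ⟨i, hi⟩ := Function.ne_iff.1 hL0
  -- The factor relating the two lifts is chosen pointwise, with no regularity known.
  -- Proportionality is expressed through coordinates instead, and this relation can be
  -- differentiated.
  have hcross : (fun s => G s i • L s) =ᶠ[nhds t] fun s => L s i • G s := by
    filter_upwards [hJ.mem_nhds htJ] with s hs
    obtain ⟨c, hc⟩ := hprop s hs
    rw [← hc, smul_smul, Pi.smul_apply, smul_eq_mul, mul_comm]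
  have hd1 := ((hasDerivAt_pi.1 hG) i).smul hLd
  have hd2 := ((hasDerivAt_pi.1 hLd) i).smul hG
  have heq := hd1.unique (hd2.congr_of_eventuallyEq hcross)
  obtain ⟨c, hc⟩ := hprop t htJ
  have hLL : herm (L t) (L t) = 0 := by
    have := hγ.1 t
    rw [eL] at this
    exact (mk_mem_quadric _ hL0).1 this
  have h := congrArg (herm (G t)) heq
  simp only [herm_add_right, herm_smul_right] at h
  have h1 : herm (G t) (L t) = 0 := by rw [← hc, herm_smul_left, hLL, mul_zero]
  have h2 : herm (G t) (deriv L t) = 0 := by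
    rw [← hc, herm_smul_left, hcontact t htJ, mul_zero]
  rw [h1, h2, herm_self_eq_zero hγ hl] at h
  have h3 : L t i * herm (G t) G' = 0 := by linear_combination -h
  exact (mul_eq_zero.1 h3).resolve_left hi

/-- The Gram matrix of the frame `(Γ, Γ', Γ'')` of a normalized lift. -/
theorem frame_herm (hγ : IsLegendrian γ) (hG : IsNormalizedLift γ G) (t : ℝ) :
    herm (iteratedDeriv 0 G t) (iteratedDeriv 0 G t) = 0 ∧
    herm (iteratedDeriv 0 G t) (iteratedDeriv 1 G t) = 0 ∧
    herm (iteratedDeriv 1 G t) (iteratedDeriv 1 G t) = 1 ∧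
    herm (iteratedDeriv 0 G t) (iteratedDeriv 2 G t) = -1 ∧
    herm (iteratedDeriv 1 G t) (iteratedDeriv 2 G t) = 0 ∧
    herm (iteratedDeriv 0 G t) (iteratedDeriv 3 G t) = 0 ∧
    herm (iteratedDeriv 1 G t) (iteratedDeriv 3 G t) =
      -herm (iteratedDeriv 2 G t) (iteratedDeriv 2 G t) := by
  obtain ⟨hsm, hl, hdet⟩ := hG
  have hd := hasDerivAt_iteratedDeriv hsm
  have hdet' : ∀ t, det3 (iteratedDeriv 0 G t) (iteratedDeriv 1 G t) (iteratedDeriv 2 G t) =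
      Complex.I := fun t => by
    rw [iteratedDeriv_zero, iteratedDeriv_one]
    exact hdet t
  have h00 : ∀ t, herm (iteratedDeriv 0 G t) (iteratedDeriv 0 G t) = 0 := fun t => by
    rw [iteratedDeriv_zero]
    exact herm_self_eq_zero hγ hl t
  have h01 : ∀ t, herm (iteratedDeriv 0 G t) (iteratedDeriv 1 G t) = 0 := fun t => by
    have := hd 0 t
    rw [iteratedDeriv_zero] at this ⊢
    exact herm_deriv_eq_zero hγ hl this
  have hzero : ∀ {f : ℝ → ℂ} {c f' : ℂ} {t : ℝ}, (∀ t, f t = c) → HasDerivAt f f' t → f' = 0 :=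
    fun {f c f' t} hf hf' => by
      rw [show f = fun _ => c from funext hf] at hf'
      exact hf'.unique (hasDerivAt_const t c)
  have h02 : ∀ t, herm (iteratedDeriv 1 G t) (iteratedDeriv 1 G t) +
      herm (iteratedDeriv 0 G t) (iteratedDeriv 2 G t) = 0 := fun t =>
    hzero h01 (hasDerivAt_herm (hd 0 t) (hd 1 t))
  -- With `p = ⟨Γ', Γ'⟩` and `⟨Γ, Γ''⟩ = -p`, the Gram determinant is `-p³ = -|i|²`, and `p` is
  -- real.
  have h11 : ∀ t, herm (iteratedDeriv 1 G t) (iteratedDeriv 1 G t) = 1 := fun t => by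
    have hgram := gram_det (iteratedDeriv 0 G t) (iteratedDeriv 1 G t) (iteratedDeriv 2 G t)
      (iteratedDeriv 0 G t) (iteratedDeriv 1 G t) (iteratedDeriv 2 G t)
    have h20 := star_herm (iteratedDeriv 0 G t) (iteratedDeriv 2 G t)
    have h10 := star_herm (iteratedDeriv 0 G t) (iteratedDeriv 1 G t)
    have h02' := h02 t
    have hself := star_herm (iteratedDeriv 1 G t) (iteratedDeriv 1 G t)
    rw [h01, star_zero] at h10
    rw [h00, h01, ← h10, ← h20, hdet'] at hgram
    generalize herm (iteratedDeriv 1 G t) (iteratedDeriv 1 G t) = p at *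
    have hp2 : herm (iteratedDeriv 0 G t) (iteratedDeriv 2 G t) = -p := by
      linear_combination h02'
    rw [hp2, star_neg, hself, Complex.star_def, Complex.conj_I] at hgram
    have hpr : p = (p.re : ℂ) := Complex.ext rfl (by
      have := congrArg Complex.im hself
      simp at this ⊢
      linarith)
    have hp3 : p ^ 3 = 1 := by
      linear_combination -hgram - Complex.I_sq
    rw [hpr] at hp3 ⊢
    have hp3' : p.re ^ 3 = 1 := by exact_mod_cast hp3
    have : (p.re - 1) * (p.re ^ 2 + p.re + 1) = 0 := by linear_combination hp3'
    have hne : p.re ^ 2 + p.re + 1 ≠ 0 := by nlinarith [sq_nonneg (2 * p.re + 1)]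
    have : p.re = 1 := by linarith [(mul_eq_zero.1 this).resolve_right hne]
    rw [this]; simp
  have h02' : ∀ t, herm (iteratedDeriv 0 G t) (iteratedDeriv 2 G t) = -1 := fun t => by
    linear_combination h02 t - h11 t
  have h03 : ∀ t, herm (iteratedDeriv 0 G t) (iteratedDeriv 3 G t) = 0 := fun t => by
    -- Constancy of the determinant gives `det (Γ, Γ', Γ''') = 0`; the mixed Gram determinant then
    -- isolates `⟨Γ, Γ'''⟩`.
    have hdd := hzero hdet' (hasDerivAt_det3 (hd 0 t) (hd 1 t) (hd 2 t))
    have hdd3 : det3 (iteratedDeriv 0 G t) (iteratedDeriv 1 G t) (iteratedDeriv 3 G t) = 0 := by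
      rw [← hdd]
      simp only [det3_eq, zero_add, Nat.reduceAdd]
      ring
    have hgram := gram_det (iteratedDeriv 0 G t) (iteratedDeriv 1 G t) (iteratedDeriv 2 G t)
      (iteratedDeriv 0 G t) (iteratedDeriv 1 G t) (iteratedDeriv 3 G t)
    have h20 := star_herm (iteratedDeriv 0 G t) (iteratedDeriv 2 G t)
    have h10 := star_herm (iteratedDeriv 0 G t) (iteratedDeriv 1 G t)
    rw [h01, star_zero] at h10
    rw [h02', star_neg, star_one] at h20
    rw [h00, h01, ← h10, ← h20, h11, hdd3] at hgram
    linear_combination hgram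
  have h12 : ∀ t, herm (iteratedDeriv 1 G t) (iteratedDeriv 2 G t) = 0 := fun t => by
    have := hzero h02' (hasDerivAt_herm (hd 0 t) (hd 2 t))
    simp only [zero_add, Nat.reduceAdd] at this
    linear_combination this - h03 t
  have h13 : herm (iteratedDeriv 1 G t) (iteratedDeriv 3 G t) =
      -herm (iteratedDeriv 2 G t) (iteratedDeriv 2 G t) := by
    have := hzero h12 (hasDerivAt_herm (hd 1 t) (hd 2 t))
    simp only [Nat.reduceAdd] at this
    linear_combination this
  exact ⟨h00 t, h01 t, h11 t, h02' t, h12 t, h03 t, h13⟩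

/-- The structure equation of a normalized lift. -/
theorem structure_equation (hγ : IsLegendrian γ) (hG : IsNormalizedLift γ G) {t b' : ℝ}
    (hb : HasDerivAt (fun t => (herm (iteratedDeriv 2 G t) (iteratedDeriv 2 G t)).re / 2) b' t) :
    iteratedDeriv 3 G t =
      (-(b' : ℂ) + (herm (iteratedDeriv 3 G t) (iteratedDeriv 2 G t)).im * Complex.I) •
        iteratedDeriv 0 G t +
      (-2 * (((herm (iteratedDeriv 2 G t) (iteratedDeriv 2 G t)).re / 2 : ℝ) : ℂ)) •
        iteratedDeriv 1 G t := by
  have hd := hasDerivAt_iteratedDeriv hG.1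
  obtain ⟨h00, h01, h11, h02, h12, h03, h13⟩ := frame_herm hγ hG t
  have hdet : det3 (iteratedDeriv 0 G t) (iteratedDeriv 1 G t) (iteratedDeriv 2 G t) ≠ 0 := by
    have := hG.2.2 t
    rw [iteratedDeriv_zero, iteratedDeriv_one, det3, this]
    exact Complex.I_ne_zero
  have h10 := star_herm (iteratedDeriv 0 G t) (iteratedDeriv 1 G t)
  have h20 := star_herm (iteratedDeriv 0 G t) (iteratedDeriv 2 G t)
  have h21 := star_herm (iteratedDeriv 1 G t) (iteratedDeriv 2 G t)
  have h32 := star_herm (iteratedDeriv 2 G t) (iteratedDeriv 3 G t)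
  rw [h01, star_zero] at h10
  rw [h02, star_neg, star_one] at h20
  rw [h12, star_zero] at h21
  have h22 : herm (iteratedDeriv 2 G t) (iteratedDeriv 2 G t) =
      ((herm (iteratedDeriv 2 G t) (iteratedDeriv 2 G t)).re : ℂ) := Complex.ext rfl (by
    have := congrArg Complex.im (star_herm (iteratedDeriv 2 G t) (iteratedDeriv 2 G t))
    simp at this ⊢
    linarith)
  have hb' : b' = (herm (iteratedDeriv 2 G t) (iteratedDeriv 3 G t)).re := by
    have h := (hasDerivAt_herm (hd 2 t) (hd 2 t))
    have h2 := (Complex.reCLM.hasFDerivAt.comp_hasDerivAt t h).div_const 2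
    rw [hb.unique h2]
    simp only [Complex.reCLM_apply, Complex.add_re, Nat.reduceAdd]
    rw [← h32]
    simp
  have h23 : herm (iteratedDeriv 2 G t) (iteratedDeriv 3 G t) =
      b' - (herm (iteratedDeriv 3 G t) (iteratedDeriv 2 G t)).im * Complex.I := by
    rw [hb', ← h32]
    apply Complex.ext <;> simp
  rw [← sub_eq_zero]
  -- Both sides have the same products with `Γ`, `Γ'` and `Γ''`, and the form is nondegenerate.
  refine eq_zero_of_herm_eq_zero hdet ?_ ?_ ?_ <;>
    rw [sub_eq_add_neg, ← neg_one_smul ℂ, herm_add_right, herm_smul_right, herm_add_right,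
      herm_smul_right, herm_smul_right]
  · rw [h00, h01, h03]; ring
  · rw [← h10, h11, h13]
    push_cast
    rw [← h22]
    ring
  · rw [← h20, ← h21, h23]; ring

/-- A curve with a normalized lift is closed if and only if the lift is periodic. -/
theorem isClosedCurve_iff (hγ : IsLegendrian γ) (hG : IsNormalizedLift γ G) :
    IsClosedCurve γ ↔ ∃ T : ℝ, 0 < T ∧ Function.Periodic G T := by
  have hl := hG.2.1
  constructor
  · rintro ⟨T, hT, hper⟩
    have hd := hasDerivAt_iteratedDeriv hG.1
    have hprop : ∀ t, ∃ c : ℂ, c • G t = G (t + T) := fun t => by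
      obtain ⟨h1, e1⟩ := hl (t + T) (Set.mem_univ _)
      obtain ⟨h2, e2⟩ := hl t (Set.mem_univ t)
      exact exists_smul_eq_of_lift (e1.symm.trans ((hper t).trans e2))
    choose c hc using hprop
    -- Since `⟨Γ'', Γ⟩ = -1`, pairing with `Γ''` recovers the pointwise factor and shows that it is
    -- differentiable.
    have hc_eq : c = fun t => -herm (iteratedDeriv 2 G t) (iteratedDeriv 0 G (t + T)) := by
      funext t
      have h20 := star_herm (iteratedDeriv 0 G t) (iteratedDeriv 2 G t)
      rw [(frame_herm hγ hG t).2.2.2.1, star_neg, star_one] at h20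
      rw [iteratedDeriv_zero] at *
      rw [← hc, herm_smul_right, ← h20]
      ring
    have hdT : ∀ n t, HasDerivAt (fun t => iteratedDeriv n G (t + T))
        (iteratedDeriv (n + 1) G (t + T)) t := fun n t => (hd n (t + T)).comp_add_const t T
    obtain ⟨c₁, hc₁⟩ : ∃ c₁ : ℝ → ℂ, ∀ t, HasDerivAt c (c₁ t) t :=
      ⟨_, fun t => by rw [hc_eq]; exact (hasDerivAt_herm (hd 2 t) (hdT 0 t)).neg⟩
    obtain ⟨c₂, hc₂⟩ : ∃ c₂ : ℝ → ℂ, ∀ t, HasDerivAt c₁ (c₂ t) t := by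
      have : c₁ = fun t => -(herm (iteratedDeriv 3 G t) (iteratedDeriv 0 G (t + T)) +
          herm (iteratedDeriv 2 G t) (iteratedDeriv 1 G (t + T))) := by
        funext t
        refine (hc₁ t).unique ?_
        rw [hc_eq]
        exact (hasDerivAt_herm (hd 2 t) (hdT 0 t)).neg
      exact ⟨_, fun t => by
        rw [this]
        exact ((hasDerivAt_herm (hd 3 t) (hdT 0 t)).add (hasDerivAt_herm (hd 2 t) (hdT 1 t))).neg⟩
    have e0 : ∀ t, iteratedDeriv 0 G (t + T) = c t • iteratedDeriv 0 G t := fun t => by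
      rw [iteratedDeriv_zero, hc]
    have e1 : ∀ t, iteratedDeriv 1 G (t + T) =
        c t • iteratedDeriv 1 G t + c₁ t • iteratedDeriv 0 G t := fun t => by
      have h := hdT 0 t
      rw [show (fun t => iteratedDeriv 0 G (t + T)) = fun t => c t • iteratedDeriv 0 G t from
        funext e0] at h
      exact h.unique ((hc₁ t).smul (hd 0 t))
    have e2 : ∀ t, iteratedDeriv 2 G (t + T) =
        (c t • iteratedDeriv 2 G t + c₁ t • iteratedDeriv 1 G t) +
        (c₁ t • iteratedDeriv 1 G t + c₂ t • iteratedDeriv 0 G t) := fun t => by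
      have h := hdT 1 t
      rw [show (fun t => iteratedDeriv 1 G (t + T)) = fun t => c t • iteratedDeriv 1 G t +
        c₁ t • iteratedDeriv 0 G t from funext e1] at h
      exact h.unique (((hc₁ t).smul (hd 1 t)).add ((hc₂ t).smul (hd 0 t)))
    have hdet : ∀ t, det3 (iteratedDeriv 0 G t) (iteratedDeriv 1 G t) (iteratedDeriv 2 G t) =
        Complex.I := fun t => by
      rw [iteratedDeriv_zero, iteratedDeriv_one]
      exact hG.2.2 t
    -- The terms with derivatives of `c` drop out of the determinant, which is scaled by `c³` and
    -- equals `i` at both points.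
    have hc3 : ∀ t, c t ^ 3 = 1 := fun t => by
      apply mul_right_cancel₀ Complex.I_ne_zero
      rw [one_mul]
      conv_rhs => rw [← hdet (t + T), e0, e1, e2]
      conv_lhs => rw [← hdet t]
      simp only [det3_eq, Pi.add_apply, Pi.smul_apply, smul_eq_mul]
      ring
    have hconst : ∀ s t, c s = c t := by
      have h0 : ∀ t, c₁ t = 0 := fun t => by
        have h := (hc₁ t).pow 3
        rw [show c ^ 3 = fun _ => (1 : ℂ) from funext hc3] at h
        have h2 := h.unique (hasDerivAt_const t 1)
        have hct : c t ≠ 0 := fun h => by simpa [h] using hc3 t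
        simpa [hct] using h2
      exact eq_of_hasDerivAt_zero fun t => by simpa [h0] using hc₁ t
    -- The factor is a constant cube root of unity, so the lift may need three turns to close.
    refine ⟨3 * T, by positivity, fun t => ?_⟩
    rw [show t + 3 * T = t + T + T + T by ring, ← hc (t + T + T), ← hc (t + T), ← hc t,
      hconst (t + T + T) t, hconst (t + T) t, smul_smul, smul_smul,
      show c t * c t * c t = c t ^ 3 by ring, hc3, one_smul]
  · rintro ⟨T, hT, hper⟩
    refine ⟨T, hT, fun t => ?_⟩
    obtain ⟨h1, e1⟩ := hl (t + T) (Set.mem_univ _)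
    obtain ⟨h2, e2⟩ := hl t (Set.mem_univ t)
    rw [e1, e2]
    simp only [hper t]

/-! ### From strings to the linear equation. -/

/-- Without a normalized lift the default value is the zero curve, whose cubic density vanishes;
genericity excludes this. -/
theorem normalizedLift_spec {γ : ℝ → CP2} (h : IsGeneric γ) :
    IsNormalizedLift γ (normalizedLift γ) := by
  by_cases hex : ∃ Γ, IsNormalizedLift γ Γ
  · rw [normalizedLift, dif_pos hex]
    exact hex.choose_spec
  · exfalso
    apply h 0
    have h2 : iteratedDeriv 2 (fun _ : ℝ => (0 : Fin 3 → ℂ)) 0 = 0 := by simp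
    rw [cubicDensity, normalizedLift, dif_neg hex, h2]
    simp [herm]

/-- The density is continuous with square one on a connected line, so its sign is constant. -/
theorem cubicDensity_eq_one_or_neg_one {γ : ℝ → CP2} (hG : IsNormalizedLift γ (normalizedLift γ))
    (hnat : IsNatural γ) :
    (∀ t, cubicDensity γ t = 1) ∨ ∀ t, cubicDensity γ t = -1 := by
  have hd := hasDerivAt_iteratedDeriv hG.1
  have hcont : Continuous (cubicDensity γ) :=
    Complex.continuous_im.comp (continuous_iff_continuousAt.2 fun t =>
      (hasDerivAt_herm (hd 3 t) (hd 2 t)).continuousAt)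
  have hsq : ∀ t, cubicDensity γ t ^ 2 = 1 := fun t => by
    have h := hnat t
    rw [strainDensity] at h
    have h3 := congrArg (fun x : ℝ => x ^ (3 : ℝ)) h
    simp only [← Real.rpow_mul (abs_nonneg _), Real.one_rpow] at h3
    norm_num at h3
    rw [← sq_abs, h3, one_pow]
  have := isPreconnected_univ.eq_or_eq_neg_of_sq_eq (f := cubicDensity γ) (g := fun _ => (1 : ℝ))
    hcont.continuousOn continuousOn_const (fun t _ => by simpa using hsq t)
    (fun _ => one_ne_zero)
  rcases this with h | h
  · exact Or.inl fun t => h (Set.mem_univ t)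
  · exact Or.inr fun t => by simpa using h (Set.mem_univ t)

/-- The closing condition of a system of three independent solutions. -/
theorem exists_periodic_iff {m ℓ : ℝ} (hm0 : 0 < m) (hm1 : m < 1) (hℓ : 0 < ℓ)
    {y : Fin 3 → Fin 3 → ℝ → ℂ}
    (hy : ∀ j, IsSolution (modelCurvature m ℓ) (modelCurvatureDeriv m ℓ) (y j))
    (hw : wronskian (y 0) (y 1) (y 2) 0 ≠ 0)
    (hper : ∀ T, (∀ j, Function.Periodic (y j 0) T) → Function.Periodic (modelCurvature m ℓ) T) :
    (∃ T : ℝ, 0 < T ∧ ∀ j, Function.Periodic (y j 0) T) ↔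
      0 < momentumDiscr m ℓ ∧ (∃ q : ℚ, Theta₂ m ℓ = (q : ℝ)) ∧ ∃ q : ℚ, Theta₃ m ℓ = (q : ℝ) := by
  rw [← exists_allPeriodic_iff hm0 hm1 hℓ]
  constructor
  · rintro ⟨T, hT, h⟩
    obtain ⟨n, hn, rfl⟩ := exists_eq_nat_mul_wavelength hm0 hm1 hℓ hT (hper T h)
    exact ⟨n, hn, fun u hu => (hy 0).periodic (hy 1) (hy 2) hu hw (h 0) (h 1) (h 2)⟩
  · rintro ⟨n, hn, h⟩
    exact ⟨n * wavelength m ℓ, mul_pos (Nat.cast_pos.2 hn) (wavelength_pos hm0 hm1 hℓ),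
      fun j => h _ (hy j)⟩

theorem iteratedDeriv_periodic {G : ℝ → Fin 3 → ℂ} (hG : ContDiff ℝ ∞ G) {T : ℝ}
    (h : Function.Periodic G T) (n : ℕ) : Function.Periodic (iteratedDeriv n G) T := by
  induction n with
  | zero => simpa using h
  | succ n ih =>
    intro t
    have h1 := (hasDerivAt_iteratedDeriv hG n (t + T)).comp_add_const t T
    rw [show (fun t => iteratedDeriv n G (t + T)) = iteratedDeriv n G from funext ih] at h1
    exact h1.unique (hasDerivAt_iteratedDeriv hG n t)

/-- The closing condition for the jets `Y n = Γ⁽ⁿ⁾` of a curve with the structure equation of a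
string. -/
theorem exists_jet_periodic_iff {m ℓ : ℝ} (hm0 : 0 < m) (hm1 : m < 1) (hℓ : 0 < ℓ)
    {Y : ℕ → ℝ → Fin 3 → ℂ} {s₀ : ℝ} (hd : ∀ n t, HasDerivAt (Y n) (Y (n + 1) t) t)
    (hdet : ∀ t, det3 (Y 0 t) (Y 1 t) (Y 2 t) ≠ 0)
    (hstr : ∀ t, Y 3 t = (-(modelCurvatureDeriv m ℓ (t + s₀) : ℂ) + Complex.I) • Y 0 t +
      (-2 * (modelCurvature m ℓ (t + s₀) : ℂ)) • Y 1 t)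
    (hper : ∀ T, Function.Periodic (Y 0) T → Function.Periodic (modelCurvature m ℓ) T) :
    (∃ T : ℝ, 0 < T ∧ Function.Periodic (Y 0) T) ↔
      0 < momentumDiscr m ℓ ∧ (∃ q : ℚ, Theta₂ m ℓ = (q : ℝ)) ∧ ∃ q : ℚ, Theta₃ m ℓ = (q : ℝ) := by
  -- The shift by `s₀` turns the curvature into exactly `κ_{m,ℓ}`; each coordinate is a scalar
  -- solution.
  set y : Fin 3 → Fin 3 → ℝ → ℂ := fun j n s => Y n (s - s₀) j
  have hdy : ∀ j n t, HasDerivAt (fun t => Y n (t - s₀) j) (Y (n + 1) (t - s₀) j) t :=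
    fun j n t => hasDerivAt_pi.1 ((hd n (t - s₀)).comp_sub_const t s₀) j
  have hy : ∀ j, IsSolution (modelCurvature m ℓ) (modelCurvatureDeriv m ℓ) (y j) := fun j =>
    { d0 := hdy j 0
      d1 := hdy j 1
      d2 := fun s => by
        refine (hdy j 2 s).congr_deriv ?_
        rw [show 2 + 1 = 3 from rfl, hstr, sub_add_cancel]
        simp only [Pi.add_apply, Pi.smul_apply, smul_eq_mul, y]
        simp only [Fin.val_zero, Fin.val_one]
        ring }
  have hw : wronskian (y 0) (y 1) (y 2) 0 ≠ 0 := by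
    intro h
    apply hdet (0 - s₀)
    rw [← h, det3_eq]
    simp only [wronskian, y, Fin.val_zero, Fin.val_one, Fin.val_two]
    ring
  have hiff : ∀ T, (∀ j, Function.Periodic (y j 0) T) ↔ Function.Periodic (Y 0) T := fun T => by
    constructor
    · intro h t
      ext j
      have := h j (t + s₀)
      simp only [y, Fin.val_zero] at this
      rwa [add_sub_cancel_right, show t + s₀ + T - s₀ = t + T by ring] at this
    · intro h j t
      simp only [y, Fin.val_zero]
      rw [show t + T - s₀ = t - s₀ + T by ring, h]
  rw [← exists_periodic_iff hm0 hm1 hℓ hy hw fun T h => hper T ((hiff T).1 h)]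
  simp only [hiff]

end CRString

end

open CRString in
theorem mainTheorem5 (m ℓ : ℝ) (hm0 : 0 < m) (hm1 : m < 1) (hℓ : 0 < ℓ)
    (γ : ℝ → CRString.CP2) (hγ : CRString.IsString γ) (hchar : CRString.HasCharacters γ m ℓ) :
    CRString.IsClosedCurve γ ↔
      0 < CRString.momentumDiscr m ℓ ∧
      (∃ q : ℚ, CRString.Theta₂ m ℓ = (q : ℝ)) ∧
      (∃ q : ℚ, CRString.Theta₃ m ℓ = (q : ℝ)) := by
  have hN := normalizedLift_spec hγ.generic
  obtain ⟨s₀, hs₀⟩ := hchar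
  have hd := hasDerivAt_iteratedDeriv hN.1
  rw [isClosedCurve_iff hγ.legendrian hN]
  have hb : ∀ t, HasDerivAt (fun t => (herm (iteratedDeriv 2 (normalizedLift γ) t)
      (iteratedDeriv 2 (normalizedLift γ) t)).re / 2) (modelCurvatureDeriv m ℓ (t + s₀)) t :=
    fun t => by
      rw [show (fun t => (herm (iteratedDeriv 2 (normalizedLift γ) t)
        (iteratedDeriv 2 (normalizedLift γ) t)).re / 2) = fun t => modelCurvature m ℓ (t + s₀)
        from funext hs₀]
      exact (hasDerivAt_modelCurvature hm0 hm1 ℓ (t + s₀)).comp_add_const t s₀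
  have hstr := fun t => structure_equation hγ.legendrian hN (hb t)
  have hcurv : ∀ T, Function.Periodic (normalizedLift γ) T →
      Function.Periodic (modelCurvature m ℓ) T := fun T hT s => by
    have h1 := hs₀ (s - s₀ + T)
    have h2 := hs₀ (s - s₀)
    rw [crCurvature, quadraticDensity, iteratedDeriv_periodic hN.1 hT 2] at h1
    rw [crCurvature, quadraticDensity] at h2
    rw [show s - s₀ + T + s₀ = s + T by ring] at h1
    rw [sub_add_cancel] at h2
    exact h1.symm.trans h2
  have hκ : ∀ t, (herm (iteratedDeriv 2 (normalizedLift γ) t)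
      (iteratedDeriv 2 (normalizedLift γ) t)).re / 2 = modelCurvature m ℓ (t + s₀) := hs₀
  have hdet : ∀ t, det3 (iteratedDeriv 0 (normalizedLift γ) t)
      (iteratedDeriv 1 (normalizedLift γ) t) (iteratedDeriv 2 (normalizedLift γ) t) =
      Complex.I := fun t => by
    rw [iteratedDeriv_zero, iteratedDeriv_one]
    exact hN.2.2 t
  rcases cubicDensity_eq_one_or_neg_one hN hγ.natural with ha | ha
  · have h := exists_jet_periodic_iff (s₀ := s₀) hm0 hm1 hℓ
      (Y := fun n => iteratedDeriv n (normalizedLift γ)) hd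
      (fun t => by rw [hdet]; exact Complex.I_ne_zero)
      (fun t => by
        have h1 := hstr t
        rw [hκ, show (herm (iteratedDeriv 3 (normalizedLift γ) t)
          (iteratedDeriv 2 (normalizedLift γ) t)).im = 1 from ha t, Complex.ofReal_one,
          one_mul] at h1
        exact h1)
      (fun T hT => hcurv T (by simpa using hT))
    simpa using h
  -- For `a = -1` the conjugate lift satisfies the equation with `+i`, has nonzero determinant, and
  -- has the same periods.
  · have hper : ∀ T, Function.Periodic (fun t => star (iteratedDeriv 0 (normalizedLift γ) t)) T ↔
        Function.Periodic (normalizedLift γ) T := fun T => by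
      simp only [Function.Periodic, iteratedDeriv_zero, star_inj]
    have h := exists_jet_periodic_iff (s₀ := s₀) hm0 hm1 hℓ
      (Y := fun n t => star (iteratedDeriv n (normalizedLift γ) t))
      (fun n t => (hd n t).star)
      (fun t h => by
        have h1 := congrArg star (hdet t)
        simp only [det3_eq, star_add, star_sub, star_mul', Pi.star_apply] at h h1
        rw [h] at h1
        simp at h1)
      (fun t => by
        have h1 := hstr t
        rw [hκ, show (herm (iteratedDeriv 3 (normalizedLift γ) t)
          (iteratedDeriv 2 (normalizedLift γ) t)).im = -1 from ha t] at h1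
        rw [h1]
        simp [star_smul])
      (fun T hT => hcurv T ((hper T).1 hT))
    simpa only [hper] using h
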